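/- Let $F$ be a number field, let $v$ be an archimedean place of $F$ with completion $F_v$ (identified with ${\mathbf R}$ or ${\mathbf C}$), let $|\cdot|_v$ be the usual absolute value on $F_v$, and let $m_v=[F_v:{\mathbf R}]$. Let $n,r\ge 0$ be integers. For $1\le k\le r$ let $Z_k\subset{\mathbf P}^n_F$ be an integral closed subscheme contained in the hyperplane $x_0=0$, given by a finite family of homogeneous polynomials $g_{k,j}\in F[x_0,\dots,x_n]$, of degrees $d_{k,j}$, that generates a prime ideal containing $x_0$. Let $X$ be the blow-up of ${\mathbf P}^n$ in the product of the ideals of $Z_1,\dots,Z_r$, let $D_k$ ($1\le k\le r$) be the inverse image of $Z_k$ and $D_0$ the strict transform of the hyperplane $x_0=0$. Over the point $(1:x_1:\dots:x_n)$ with $x=(x_1,\dots,x_n)\in F_v^n$ the canonical sections have the norms $$\|\mathsf s_{D_k}\|_v(x)=\Big(\sum_j\frac{|g_{k,j}(1,x_1,\dots,x_n)|_v^2}{(1+\sum_{i=1}^n|x_i|_v^2)^{d_{k,j}}}\Big)^{1/2}\quad(1\le k\le r),$$ $$\|\mathsf s_{D_0}\|_v(x)=\Big(1+\sum_{i=1}^n|x_i|_v^2\Big)^{-1/2}\prod_{k=1}^r\|\mathsf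 s_{D_k}\|_v(x)^{-1}.$$ For $\mathbf s=(s_0,\dots,s_r)\in{\mathbf C}^{r+1}$ put $H_v(\mathbf s;x)=\prod_{k=0}^r\|\mathsf s_{D_k}\|_v(x)^{-m_vs_k}$. For $\mathbf a\in F_v^n$ let $\psi_{\mathbf a}(x)=\exp(-2\pi i\,\mathrm{tr}_{F_v/{\mathbf R}}(\sum_i a_ix_i))$, and let $$\hat H_v(\mathbf s;\psi_{\mathbf a})=\int_{F_v^n}H_v(\mathbf s;x)^{-1}\psi_{\mathbf a}(x)\,d\mu_v(x),$$ where $\mu_v$ is the self-dual Haar measure on $F_v^n$ (the $n$-fold product of $dx$ if $F_v={\mathbf R}$, and of $2\,dx\,dy$ if $F_v={\mathbf C}$). Let $K\subset{\mathbf R}^{r+1}$ be a compact subset such that $H_v(\sigma;\cdot)^{-1}$ is integrable on $F_v^n$ for every $\sigma\in K$. Then for every integer $d\ge1$ there is a constant $c(d,K)$ such that for all $\mathbf a\in F_v^n$ and all $\mathbf s\in{\mathbf C}^{r+1}$ with $\mathrm{Re}(\mathbf s)\in K$, $$|\hat H_v(\mathbf s;\psi_{\mathbf a})|\le c(d,K)\left(\frac{1+\|\mathrm{Im}(\mathbf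 s)\|}{1+\|\mathbf a\|}\right)^d,$$ where $\|\cdot\|$ denotes the maximum norm on ${\mathbf R}^{r+1}$ and on $F_v^n$. -/

import Mathlib

open MeasureTheory NumberField
open scoped BigOperators ENNReal

noncomputable section

/-- Centres `Z₁, …, Z_r` of a blow-up of projective `n`-space over `F`: each `Z_k` is an integral
closed subscheme contained in the hyperplane `x₀ = 0`, given by a finite family of homogeneous
generators `g_{k,j}`, of degrees `d_{k,j}`, of a homogeneous prime ideal containing `x₀`. -/
structure BlowupCentres (F : Type*) [Field F] (n r : ℕ) where
  /-- The number of generators of the ideal of `Z_k`. -/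
  numGens : Fin r → ℕ
  /-- The generators `g_{k,j}`. -/
  gen : (k : Fin r) → Fin (numGens k) → MvPolynomial (Fin (n + 1)) F
  /-- The degrees `d_{k,j}`. -/
  deg : (k : Fin r) → Fin (numGens k) → ℕ
  gen_homogeneous : ∀ k j, (gen k j).IsHomogeneous (deg k j)
  ideal_isPrime : ∀ k, (Ideal.span (Set.range (gen k))).IsPrime
  X_zero_mem_ideal : ∀ k, MvPolynomial.X 0 ∈ Ideal.span (Set.range (gen k))

namespace ArchimedeanPlace

variable {F : Type*} [Field F] (v : InfinitePlace F)

instance : MeasurableSpace v.Completion := borel v.Completion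

instance : BorelSpace v.Completion := ⟨rfl⟩

open Classical in
/-- The Haar measure on `F_v` that is self-dual for the character `x ↦ exp(-2πi tr(x))`:
Lebesgue measure `dx` if `F_v = ℝ`, and twice Lebesgue measure, `2 dx dy`, if `F_v = ℂ`. -/
def haar : Measure v.Completion :=
  if h : v.IsReal then
    Measure.map (InfinitePlace.Completion.isometryEquivRealOfIsReal h).symm volume
  else
    (2 : ℝ≥0∞) • Measure.map (InfinitePlace.Completion.isometryEquivComplexOfIsComplex
      (InfinitePlace.not_isReal_iff_isComplex.mp h)).symm volume

/-- The Haar measure on `F_v^n`. -/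
def haarPi (n : ℕ) : Measure (Fin n → v.Completion) :=
  Measure.pi fun _ => haar v

/-- The trace from `F_v` to `ℝ`: the identity if `F_v = ℝ`, and `z ↦ 2 Re z` if `F_v = ℂ`. -/
def traceReal (x : v.Completion) : ℝ :=
  (v.mult : ℝ) * (InfinitePlace.Completion.extensionEmbedding v x).re

/-- The character `ψ_a(x) = exp(-2πi tr ⟨a, x⟩)` of `F_v^n`. -/
def psi {n : ℕ} (a x : Fin n → v.Completion) : ℂ :=
  Complex.exp (-(2 * (Real.pi : ℂ) * Complex.I * (traceReal v (∑ i, a i * x i) : ℂ)))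

end ArchimedeanPlace

namespace BlowupCentres

variable {F : Type*} [Field F] {n r : ℕ} (B : BlowupCentres F n r) (v : InfinitePlace F)

/-- The norm of the canonical section of `O(D_k)`, `D_k` being the inverse image of `Z_k`, at a
point of the blow-up above `(y₀ : … : y_n)`:
`‖s_{D_k}‖² = ∑_j |g_{k,j}(y)|² / (|y₀|² + … + |y_n|²)^{d_{k,j}}`. -/
def centreNorm (k : Fin r) (y : Fin (n + 1) → v.Completion) : ℝ :=
  Real.sqrt (∑ j, ‖MvPolynomial.aeval y (B.gen k j)‖ ^ 2 / (∑ i, ‖y i‖ ^ 2) ^ B.deg k j)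

/-- The norm of the section `x₀` of `O(1)` at `(y₀ : … : y_n)`. -/
def hyperplaneNorm (y : Fin (n + 1) → v.Completion) : ℝ :=
  ‖y 0‖ / Real.sqrt (∑ i, ‖y i‖ ^ 2)

/-- The norms of the canonical sections of `O(D_0), O(D_1), …, O(D_r)` at a point above
`(y₀ : … : y_n)` with `y₀ ≠ 0`. Here `D_0` is the strict transform of the hyperplane `x₀ = 0`;
`O(D_0)` is metrized through the isomorphism of `O(D_0 + D_1 + … + D_r)` with the pull-back of
`O(1)`, under which the product of the canonical sections corresponds to `x₀`. -/
def sectionNorm (y : Fin (n + 1) → v.Completion) : Fin (r + 1) → ℝ :=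
  Fin.cons (hyperplaneNorm v y / ∏ k, B.centreNorm v k y) (fun k => B.centreNorm v k y)

/-- The exponential local height of `x ∈ F_v^n` with respect to `s₀ D₀ + … + s_r D_r`:
`H_v(s; x) = ∏_k ‖s_{D_k}‖_v(1 : x₁ : … : x_n) ^ (-m_v s_k)`, where `m_v = [F_v : ℝ]`. -/
def localHeight (s : Fin (r + 1) → ℂ) (x : Fin n → v.Completion) : ℂ :=
  ∏ k, (B.sectionNorm v (Fin.cons 1 x : Fin (n + 1) → v.Completion) k : ℂ) ^
    (-((v.mult : ℂ) * s k))

/-- The Fourier transform of `H_v(s; ·)⁻¹` at the character `ψ_a`. -/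
def localFourier (s : Fin (r + 1) → ℂ) (a : Fin n → v.Completion) : ℂ :=
  ∫ x, (B.localHeight v s x)⁻¹ * ArchimedeanPlace.psi v a x ∂(ArchimedeanPlace.haarPi v n)

end BlowupCentres

end

/-!
In real coordinates `y ∈ ℝ ^ N` on `F_v ^ n` (with `N = n` or `N = 2n`), the function `H_v(s; ·)⁻¹`
is a product `∏ l, P l ^ λ l` of complex powers of real polynomials, with exponents `λ l` linear in
`s`: `P 0` is `Q = 1 + ∑ |x_i|²`, and the square of the norm of the canonical section of `O(D_k)` is
the quotient of `P k` by a power of `Q`. Since `x₀` lies in the ideal of `Z_k`, this square is at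
least a multiple of `1 / Q`. Hence `P k` has degree at most `m + 2` and is at least a
multiple of `(1 + ‖y‖) ^ m` (`RealPolynomial.Tame`, `exists_tame_sum_norm_sq_div`). This alone
implies that each iterated partial derivative `∂_j ^ a (P k)` is dominated by `P k`
(`Tame.abs_iterate_pderiv_le`), so that `∂_j ^ d` multiplies the product of powers by a polynomial
of degree at most `d` in `λ` with bounded coefficients. Integration by parts `d` times gives the
decay of the Fourier transform, with the constant `∫ H_v(Re s; ·)⁻¹`
(`exists_pow_mul_norm_fourier_le`).

It remains to bound this integral uniformly for `Re s ∈ K`. As `K` may be any compact set of points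
of convergence, this uses that the set of points of convergence is open, in the following sense:
if `f = ∏ l, P l ^ σ l` is integrable, then so is `f * Q ^ δ` for some `δ > 0`
(`exists_integrable_exp_logProd_add`). Resolution of singularities is avoided by an argument in the
style of Bernstein and Zeilberger. Put `Z t = ∫ f * Q ^ t` for `t ≤ 0`. By a count of
dimensions the derivatives `∂ ^ α (f * Q ^ (t - i))` satisfy a nontrivial linear relation whose
coefficients are polynomials in `t`. Integrated against a monomial it becomes a linear difference
equation for `Z` (`PowerFamily.exists_recurrence`), which continues `Z` meromorphically beyond `0`.
As `Z` is bounded to the left of `0`, there is no pole at `0`. As `Z` is the moment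
generating function of the nonnegative variable `log Q`, Landau's principle then shows that the
integral converges for some `t > 0`
(`ProbabilityTheory.exists_integrable_exp_mul_of_recurrence`).
-/

open Filter Topology MvPolynomial

/-! ### Growth and derivatives of real polynomials -/

namespace RealPolynomial

variable {N : ℕ}

theorem totalDegree_pderiv_le {σ R : Type*} [CommSemiring R] (p : MvPolynomial σ R) (j : σ) :
    (pderiv j p).totalDegree ≤ p.totalDegree - 1 := by
  classical
  refine Finset.sup_le fun m hm => ?_
  rw [mem_support_iff, coeff_pderiv] at hm
  have h : m + Finsupp.single j 1 ∈ p.support := by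
    rw [mem_support_iff]
    intro h0
    simp [h0] at hm
  have h2 := le_totalDegree h
  rw [Finsupp.sum_add_index' (by simp) (by simp), Finsupp.sum_single_index rfl] at h2
  omega

theorem totalDegree_iterate_pderiv_le {σ R : Type*} [CommSemiring R] (p : MvPolynomial σ R)
    (j : σ) (a : ℕ) : ((pderiv j)^[a] p).totalDegree ≤ p.totalDegree - a := by
  induction a with
  | zero => simp
  | succ a ih =>
    rw [Function.iterate_succ_apply']
    have := totalDegree_pderiv_le ((pderiv j)^[a] p) j
    omega

theorem abs_eval_le (p : MvPolynomial (Fin N) ℝ) {m : ℕ} (hp : p.totalDegree ≤ m) :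
    ∃ C, 0 ≤ C ∧ ∀ x : Fin N → ℝ, |eval x p| ≤ C * (1 + ‖x‖) ^ m := by
  refine ⟨∑ d ∈ p.support, |coeff d p|, by positivity, fun x => ?_⟩
  rw [eval_eq', Finset.sum_mul]
  refine (Finset.abs_sum_le_sum_abs _ _).trans (Finset.sum_le_sum fun d hd => ?_)
  rw [abs_mul, Finset.abs_prod]
  refine mul_le_mul_of_nonneg_left ?_ (abs_nonneg _)
  have h1 : (1 : ℝ) ≤ 1 + ‖x‖ := by linarith [norm_nonneg x]
  have h2 : ∑ i, d i ≤ m := by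
    have := le_totalDegree hd
    rw [Finsupp.sum_fintype _ _ (by simp)] at this
    omega
  calc ∏ i, |x i ^ d i| ≤ ∏ i, (1 + ‖x‖) ^ d i := by
        refine Finset.prod_le_prod (fun i _ => abs_nonneg _) fun i _ => ?_
        rw [abs_pow]
        refine pow_le_pow_left₀ (abs_nonneg _) ?_ _
        have := norm_le_pi_norm x i
        rw [Real.norm_eq_abs] at this
        linarith
    _ = (1 + ‖x‖) ^ ∑ i, d i := by rw [Finset.prod_pow_eq_pow_sum]
    _ ≤ _ := pow_le_pow_right₀ h1 h2

theorem hasDerivAt_eval_line (p : MvPolynomial (Fin N) ℝ) (j : Fin N) (x : Fin N → ℝ) (t : ℝ) :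
    HasDerivAt (fun t : ℝ => eval (x + t • Pi.single j (1 : ℝ)) p)
      (eval (x + t • Pi.single j (1 : ℝ)) (pderiv j p)) t := by
  induction p using MvPolynomial.induction_on with
  | C a => simpa using hasDerivAt_const t a
  | add p q hp hq => simp only [map_add]; exact hp.add hq
  | mul_X p i hp =>
    have hX : HasDerivAt (fun t : ℝ => (x + t • (Pi.single j (1 : ℝ) : Fin N → ℝ)) i)
        ((Pi.single j (1 : ℝ) : Fin N → ℝ) i) t := by
      have := ((hasDerivAt_id t).mul_const ((Pi.single j (1 : ℝ) : Fin N → ℝ) i)).const_add (x i)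
      simpa using this
    have := hp.fun_mul hX
    simp only [pderiv_mul, map_add, map_mul, eval_X]
    refine this.congr_deriv ?_
    rw [pderiv_X]
    rcases eq_or_ne i j with rfl | h
    · simp
    · simp [h]

theorem hasLineDerivAt_eval (p : MvPolynomial (Fin N) ℝ) (j : Fin N) (x : Fin N → ℝ) :
    HasLineDerivAt ℝ (fun x => eval x p) (eval x (pderiv j p)) x (Pi.single j 1) := by
  simpa [HasLineDerivAt] using hasDerivAt_eval_line p j x 0

/-- A real polynomial of degree at most `m + 2` that is bounded below by a positive multiple of
`(1 + ‖x‖) ^ m`. -/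
def Tame (p : MvPolynomial (Fin N) ℝ) : Prop :=
  ∃ (m : ℕ) (c : ℝ), 0 < c ∧ p.totalDegree ≤ m + 2 ∧ ∀ x : Fin N → ℝ, c * (1 + ‖x‖) ^ m ≤ eval x p

theorem Tame.exists_pos_le {p : MvPolynomial (Fin N) ℝ} (hp : Tame p) :
    ∃ c : ℝ, 0 < c ∧ ∀ x : Fin N → ℝ, c ≤ eval x p := by
  obtain ⟨m, c, hc, -, h⟩ := hp
  refine ⟨c, hc, fun x => le_trans ?_ (h x)⟩
  exact le_mul_of_one_le_right hc.le (one_le_pow₀ (by linarith [norm_nonneg x]))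

theorem Tame.pos {p : MvPolynomial (Fin N) ℝ} (hp : Tame p) (x : Fin N → ℝ) : 0 < eval x p := by
  obtain ⟨c, hc, h⟩ := hp.exists_pos_le
  exact hc.trans_le (h x)

/-- The derivatives of a tame polynomial are dominated by the polynomial. From order two on this
is a matter of degrees. For the first derivative it follows from the positivity of the polynomial
at the points `x ± e_j` and from the bound for the second derivative on the segment between. -/
theorem Tame.abs_iterate_pderiv_le {p : MvPolynomial (Fin N) ℝ} (hp : Tame p) (j : Fin N)
    (a : ℕ) : ∃ C, 0 ≤ C ∧ ∀ x : Fin N → ℝ, |eval x ((pderiv j)^[a] p)| ≤ C * eval x p := by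
  have hpos := hp.pos
  obtain ⟨m, c, hc, hdeg, hlow⟩ := hp
  have key : ∀ q : MvPolynomial (Fin N) ℝ, q.totalDegree ≤ m →
      ∃ C, 0 ≤ C ∧ ∀ x y : Fin N → ℝ, ‖y‖ ≤ 1 + ‖x‖ → |eval y q| ≤ C * eval x p := by
    intro q hq
    obtain ⟨C, hC, h⟩ := abs_eval_le q hq
    refine ⟨C * 2 ^ m / c, by positivity, fun x y hxy => (h y).trans ?_⟩
    have h1 : (1 + ‖y‖) ^ m ≤ 2 ^ m * (1 + ‖x‖) ^ m := by
      rw [← mul_pow]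
      exact pow_le_pow_left₀ (by positivity) (by linarith [norm_nonneg x]) _
    calc C * (1 + ‖y‖) ^ m ≤ C * (2 ^ m * (1 + ‖x‖) ^ m) := by gcongr
      _ = C * 2 ^ m / c * (c * (1 + ‖x‖) ^ m) := by field_simp
      _ ≤ _ := by gcongr; exact hlow x
  match a with
  | 0 => exact ⟨1, zero_le_one, fun x => by simp [abs_of_pos (hpos x)]⟩
  | 1 =>
    obtain ⟨C, hC, h⟩ := key (pderiv j (pderiv j p)) <| by
      have h1 := totalDegree_pderiv_le (pderiv j p) j
      have h2 := totalDegree_pderiv_le p j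
      omega
    refine ⟨1 + C, by positivity, fun x => ?_⟩
    set M := C * eval x p with hM
    set e : Fin N → ℝ := Pi.single j 1 with he
    have hline (t : ℝ) (ht : |t| ≤ 1) : ‖x + t • e‖ ≤ 1 + ‖x‖ := by
      have h1 : ‖e‖ = 1 := by rw [he, Pi.norm_single]; simp
      have := norm_add_le x (t • e)
      rw [norm_smul, h1, Real.norm_eq_abs] at this
      linarith
    have hd (t : ℝ) := hasDerivAt_eval_line p j x t
    have hdd (t : ℝ) := hasDerivAt_eval_line (pderiv j p) j x t
    have hbd (t : ℝ) (ht : t ∈ Set.Icc (-1 : ℝ) 1) :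
        |eval (x + t • e) (pderiv j p) - eval x (pderiv j p)| ≤ M := by
      have hM0 : 0 ≤ M := mul_nonneg hC (hpos x).le
      have := (convex_Icc (-1 : ℝ) 1).norm_image_sub_le_of_norm_hasDerivWithin_le
        (f := fun t => eval (x + t • e) (pderiv j p))
        (fun s _ => (hdd s).hasDerivWithinAt)
        (fun s hs => h x _ (hline s (abs_le.2 hs))) (x := 0) (y := t)
        ⟨by norm_num, by norm_num⟩ ht
      simp only [zero_smul, add_zero, sub_zero, Real.norm_eq_abs] at this
      exact this.trans (mul_le_of_le_one_right hM0 (abs_le.2 ht))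
    have hcont : Continuous fun t : ℝ => eval (x + t • e) p :=
      continuous_iff_continuousAt.2 fun t => (hd t).continuousAt
    obtain ⟨s, hs, hs'⟩ := exists_hasDerivAt_eq_slope (fun t => eval (x + t • e) p) _
      (zero_lt_one' ℝ) hcont.continuousOn (fun t _ => hd t)
    obtain ⟨s', hs2, hs2'⟩ := exists_hasDerivAt_eq_slope (fun t => eval (x + t • e) p) _
      (neg_one_lt_zero (R := ℝ)) hcont.continuousOn (fun t _ => hd t)
    have b1 := abs_le.1 (hbd s ⟨by linarith [hs.1], hs.2.le⟩)
    have b2 := abs_le.1 (hbd s' ⟨hs2.1.le, by linarith [hs2.2]⟩)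
    have p1 := hpos (x + (1 : ℝ) • e)
    have p2 := hpos (x + (-1 : ℝ) • e)
    norm_num at hs' hs2' p1 p2
    simp only [Function.iterate_one]
    rw [abs_le]
    constructor <;> nlinarith
  | a + 2 =>
    obtain ⟨C, hC, h⟩ := key ((pderiv j)^[a + 2] p) <| by
      have := totalDegree_iterate_pderiv_le p j (a + 2)
      omega
    exact ⟨C, hC, fun x => h x x (by linarith [norm_nonneg x])⟩

end RealPolynomial

/-! ### Landau's principle for moment generating functions -/

namespace ProbabilityTheory

variable {Ω : Type*} [MeasurableSpace Ω] {X : Ω → ℝ} {μ : Measure Ω}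

theorem Iio_zero_subset_interior_integrableExpSet [IsFiniteMeasure μ] (hX : Measurable X)
    (hX0 : ∀ ω, 0 ≤ X ω) : Set.Iio 0 ⊆ interior (integrableExpSet X μ) := by
  refine interior_maximal (fun t ht => ?_) isOpen_Iio
  refine Integrable.mono' (integrable_const (1 : ℝ)) (by fun_prop) (ae_of_all _ fun ω => ?_)
  rw [Real.norm_eq_abs, Real.abs_exp, Real.exp_le_one_iff]
  exact mul_nonpos_of_nonpos_of_nonneg (le_of_lt ht) (hX0 ω)

/-- Landau's principle: if the moment generating function of a nonnegative variable continues
analytically beyond `0`, then it converges beyond `0`. Its Taylor coefficients at a negative point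
are nonnegative, so that the convergence of the Taylor series at a point `δ > 0` gives, by Tonelli's
theorem, the integrability of `exp (δ X)`. -/
theorem exists_integrable_exp_mul_of_analyticAt [IsFiniteMeasure μ] (hX : Measurable X)
    (hX0 : ∀ ω, 0 ≤ X ω) {g : ℝ → ℝ} (hg : AnalyticAt ℝ g 0)
    (h : ∀ᶠ t in 𝓝[<] 0, mgf X μ t = g t) :
    ∃ δ > 0, Integrable (fun ω => Real.exp (δ * X ω)) μ := by
  obtain ⟨p, ρ, hp⟩ := hg
  obtain ⟨l, hl, hl2⟩ := (mem_nhdsLT_iff_exists_Ioo_subset' (show (-1 : ℝ) < 0 by norm_num)).1 h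
  obtain ⟨ρ', hρ', hρ''⟩ := ENNReal.lt_iff_exists_real_btwn.1 hp.r_pos
  have hρ'0 : 0 < ρ' := by
    by_contra! h0
    simp [ENNReal.ofReal_of_nonpos h0] at hρ''
  -- The continuation has a power series on the ball of radius `r` about `0` and agrees with the
  -- moment generating function on `(-r, 0)`. The expansion about `v = -r / 4` converges at
  -- distance `r / 2` from `v`, that is at `r / 4`.
  set r : ℝ := min ρ' (-l) with hr
  have hl0 : l < 0 := hl
  have hr0 : 0 < r := lt_min hρ'0 (by linarith)
  have hrl : l ≤ -r := by linarith [min_le_right ρ' (-l)]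
  have hrρ : ENNReal.ofReal r < ρ :=
    (ENNReal.ofReal_le_ofReal (min_le_left _ _)).trans_lt hρ''.2
  set v : ℝ := -(r / 4) with hv
  have hv4 : (‖v‖₊ : ℝ≥0∞) = ENNReal.ofReal (r / 4) := by
    rw [hv, nnnorm_neg, ← enorm_eq_nnnorm, Real.enorm_eq_ofReal (by positivity)]
  have hch := hp.changeOrigin (y := v) <| by
    rw [hv4]; exact (ENNReal.ofReal_le_ofReal (by linarith)).trans_lt hrρ
  rw [zero_add] at hch
  have hvint : v ∈ interior (integrableExpSet X μ) :=
    Iio_zero_subset_interior_integrableExpSet hX hX0 (by rw [Set.mem_Iio]; linarith)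
  have heq : g =ᶠ[𝓝 v] mgf X μ := by
    filter_upwards [Ioo_mem_nhds (show l < v by linarith) (show v < 0 by linarith)] with t ht
    exact (hl2 ht).symm
  have hpeq := (hch.hasFPowerSeriesAt.congr heq).eq_formalMultilinearSeries
    (hasFPowerSeriesAt_mgf hvint)
  rw [hpeq] at hch
  have hsum := hch.hasSum (y := r / 2) <| by
    rw [Metric.mem_eball, edist_zero_right, Real.enorm_eq_ofReal (by positivity), hv4]
    refine lt_tsub_iff_right.2 ?_
    rw [← ENNReal.ofReal_add (by positivity) (by positivity)]
    exact (ENNReal.ofReal_le_ofReal (by linarith)).trans_lt hrρ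
  have hsumm := hsum.summable
  simp only [FormalMultilinearSeries.ofScalars_apply_eq, smul_eq_mul] at hsumm
  refine ⟨r / 4, by positivity, ?_⟩
  have hint (n : ℕ) : Integrable (fun ω => X ω ^ n * Real.exp (v * X ω)) μ :=
    integrable_pow_mul_exp_of_mem_interior_integrableExpSet hvint n
  refine ⟨by fun_prop, ?_⟩
  rw [hasFiniteIntegral_iff_ofReal (ae_of_all _ fun ω => (Real.exp_pos _).le)]
  set a : ℕ → Ω → ℝ := fun n ω => (X ω ^ n * Real.exp (v * X ω)) * ((r / 2) ^ n / n.factorial)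
    with ha
  have ha0 (n : ℕ) (ω : Ω) : 0 ≤ a n ω := by
    have := hX0 ω
    positivity
  have hexp (ω : Ω) : HasSum (fun n => a n ω) (Real.exp (r / 4 * X ω)) := by
    have h1 := (NormedSpace.expSeries_div_hasSum_exp (r / 2 * X ω)).mul_right (Real.exp (v * X ω))
    rw [← Real.exp_eq_exp_ℝ, ← Real.exp_add] at h1
    rw [show r / 2 * X ω + v * X ω = r / 4 * X ω by rw [hv]; ring] at h1
    refine h1.congr_fun fun n => ?_
    simp only [ha]
    ring
  calc ∫⁻ ω, ENNReal.ofReal (Real.exp (r / 4 * X ω)) ∂μ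
      = ∫⁻ ω, ∑' n, ENNReal.ofReal (a n ω) ∂μ := by
        refine lintegral_congr fun ω => ?_
        rw [← (hexp ω).tsum_eq, ENNReal.ofReal_tsum_of_nonneg (fun n => ha0 n ω) (hexp ω).summable]
    _ = ∑' n, ∫⁻ ω, ENNReal.ofReal (a n ω) ∂μ := lintegral_tsum fun n => by
        simp only [ha]
        fun_prop
    _ = ∑' n, ENNReal.ofReal (∫ ω, a n ω ∂μ) := by
        refine tsum_congr fun n => ?_
        rw [ofReal_integral_eq_lintegral_ofReal ((hint n).mul_const _) (ae_of_all _ (ha0 n))]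
    _ < ∞ := by
        refine Summable.tsum_ofReal_lt_top (hsumm.congr fun n => ?_)
        simp only [ha, integral_mul_const]
        ring

/-- A bounded function on the left of `0` whose product with a power of the variable continues
analytically to `0` continues analytically to `0` itself. -/
theorem exists_analyticAt_of_pow_mul {Z U : ℝ → ℝ} {k : ℕ} {M : ℝ} (hU : AnalyticAt ℝ U 0)
    (h : ∀ᶠ t in 𝓝[<] 0, t ^ k * Z t = U t) (hZ : ∀ᶠ t in 𝓝[<] 0, |Z t| ≤ M) :
    ∃ g : ℝ → ℝ, AnalyticAt ℝ g 0 ∧ ∀ᶠ t in 𝓝[<] 0, Z t = g t := by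
  have hneg : ∀ᶠ t in 𝓝[<] (0 : ℝ), t < 0 := self_mem_nhdsWithin
  by_cases hz : ∀ᶠ t in 𝓝 0, U t = 0
  · refine ⟨0, analyticAt_const, ?_⟩
    filter_upwards [h, hneg, hz.filter_mono nhdsWithin_le_nhds] with t h1 h2 h3
    rw [h3] at h1
    exact (mul_eq_zero.1 h1).resolve_left (pow_ne_zero _ h2.ne)
  obtain ⟨l, q, hq, hq0, hUq⟩ := hU.exists_eventuallyEq_pow_smul_nonzero_iff.2 hz
  simp only [sub_zero, smul_eq_mul] at hUq
  replace hUq := hUq.filter_mono (nhdsWithin_le_nhds (s := Set.Iio 0))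
  rcases le_or_gt k l with hkl | hkl
  · refine ⟨fun t => t ^ (l - k) * q t, (analyticAt_id.pow _).mul hq, ?_⟩
    filter_upwards [h, hneg, hUq] with t h1 h2 h3
    rw [h3, ← Nat.add_sub_cancel' hkl, pow_add, mul_assoc] at h1
    simpa using mul_left_cancel₀ (pow_ne_zero _ h2.ne) h1
  · -- then `q = t ^ (k - l) * Z` tends to `0` from the left, although `q 0 ≠ 0`
    exfalso
    have h0 : Tendsto (fun t : ℝ => |t| ^ (k - l) * M) (𝓝[<] 0) (𝓝 0) := by
      have : Continuous fun t : ℝ => |t| ^ (k - l) * M := by fun_prop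
      have h1 := this.tendsto 0
      rw [abs_zero, zero_pow (by omega), zero_mul] at h1
      exact h1.mono_left nhdsWithin_le_nhds
    have h1 : Tendsto q (𝓝[<] 0) (𝓝 0) := by
      refine squeeze_zero_norm' ?_ h0
      filter_upwards [h, hneg, hUq, hZ] with t h1 h2 h3 h4
      rw [h3, ← Nat.add_sub_cancel' hkl.le, pow_add, mul_assoc] at h1
      rw [← mul_left_cancel₀ (pow_ne_zero _ h2.ne) h1, Real.norm_eq_abs, abs_mul, abs_pow]
      gcongr
    exact hq0 (tendsto_nhds_unique (hq.continuousAt.tendsto.mono_left nhdsWithin_le_nhds) h1)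

/-- If the moment generating function of a nonnegative variable satisfies a linear difference
equation with polynomial coefficients near `-∞`, then it converges beyond `0`: the equation
continues it meromorphically to a neighbourhood of `0`, and as it is bounded to the left of `0`
there is no pole, so that Landau's principle applies. -/
theorem exists_integrable_exp_mul_of_recurrence [IsFiniteMeasure μ] (hX : Measurable X)
    (hX0 : ∀ ω, 0 ≤ X ω) {n : ℕ} (c : ℕ → Polynomial ℝ) (hc : ∃ i < n, c i ≠ 0)
    (h : ∀ᶠ t in atBot, ∑ i ∈ Finset.range n, (c i).eval t * mgf X μ (t - i) = 0) :
    ∃ δ > 0, Integrable (fun ω => Real.exp (δ * X ω)) μ := by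
  classical
  have hsub := Iio_zero_subset_interior_integrableExpSet (μ := μ) hX hX0
  -- shift the equation so that its first nonzero term is the value at `t`
  set m := Nat.find hc with hm
  obtain ⟨hmn, hcm⟩ := Nat.find_spec hc
  have hlow (i : ℕ) (hi : i < m) : c i = 0 := by
    by_contra h0
    exact Nat.find_min hc hi ⟨hi.trans hmn, h0⟩
  -- `C * Z = W` where `W` involves only values of `Z` at points at most `t - 1`, so that `W` is
  -- analytic up to `1`
  set C : ℝ → ℝ := fun t => (c m).eval (t + m) with hC
  set W : ℝ → ℝ := fun t => -∑ i ∈ Finset.Ico (m + 1) n, (c i).eval (t + m) * mgf X μ (t + m - i)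
    with hW
  have hpoly (p : Polynomial ℝ) (s : ℝ) : AnalyticOnNhd ℝ (fun t => p.eval (t + s)) Set.univ := by
    have h1 := AnalyticOnNhd.eval_polynomial (𝕜 := ℝ) p
    exact h1.comp (fun t _ => analyticAt_id.add analyticAt_const) (fun _ _ => Set.mem_univ _)
  have hWan : AnalyticOnNhd ℝ W (Set.Iio 1) := by
    intro t ht
    refine AnalyticAt.neg (Finset.analyticAt_fun_sum _ fun i hi => ?_)
    refine (hpoly _ _ t (Set.mem_univ _)).mul ?_
    have hlt : t + m - i < 0 := by
      have : ((m : ℝ) + 1) ≤ i := by exact_mod_cast (Finset.mem_Ico.1 hi).1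
      have ht' : t < 1 := ht
      linarith
    have hin : AnalyticAt ℝ (fun t : ℝ => t + (m : ℝ) - (i : ℝ)) t :=
      (analyticAt_id.add analyticAt_const).sub analyticAt_const
    exact (analyticAt_mgf (hsub hlt)).comp_of_eq hin rfl
  have hCW : Set.EqOn (fun t => C t * mgf X μ t) W (Set.Iio 0) := by
    have hA : AnalyticOnNhd ℝ (fun t => C t * mgf X μ t) (Set.Iio 0) := fun t ht =>
      (hpoly _ _ t (Set.mem_univ _)).mul (analyticAt_mgf (hsub ht))
    have hev : ∀ᶠ t in atBot, C t * mgf X μ t = W t := by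
      have h1 := (tendsto_atBot_add_const_right atBot (m : ℝ) tendsto_id).eventually h
      filter_upwards [h1] with t ht
      rw [id, ← Finset.sum_range_add_sum_Ico _ hmn.le,
        Finset.sum_eq_zero (fun i hi => by simp [hlow i (Finset.mem_range.1 hi)]), zero_add,
        Finset.sum_eq_sum_Ico_succ_bot hmn, add_sub_cancel_right] at ht
      simp only [hC, hW]
      linarith
    obtain ⟨b, hb⟩ := eventually_atBot.1 hev
    have hz : min b 0 - 1 ∈ Set.Iio (0 : ℝ) := by
      rw [Set.mem_Iio]
      linarith [min_le_right b 0]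
    refine hA.eqOn_of_preconnected_of_eventuallyEq
      (hWan.mono (Set.Iio_subset_Iio zero_le_one)) isPreconnected_Iio hz ?_
    filter_upwards [Iio_mem_nhds (show min b 0 - 1 < b by linarith [min_le_left b 0])] with t ht
    exact hb t (le_of_lt ht)
  have hCz : ¬ ∀ᶠ t in 𝓝 0, C t = 0 := by
    intro h0
    have h1 := (hpoly (c m) m).eqOn_of_preconnected_of_eventuallyEq
      (analyticOnNhd_const (v := (0 : ℝ))) isPreconnected_univ (Set.mem_univ 0) h0
    refine hcm (Polynomial.funext fun t => ?_)
    have := h1 (Set.mem_univ (t - m))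
    simpa using this
  obtain ⟨k, u, hu, hu0, hCu⟩ :=
    (hpoly (c m) m 0 (Set.mem_univ _)).exists_eventuallyEq_pow_smul_nonzero_iff.2 hCz
  have hne : ∀ᶠ t in 𝓝 0, u t ≠ 0 := hu.continuousAt.eventually_ne hu0
  obtain ⟨g, hg, hg'⟩ := exists_analyticAt_of_pow_mul (Z := mgf X μ) (k := k) (M := mgf X μ 0)
    ((hWan 0 (by simp)).div hu hu0) (by
      filter_upwards [hCu.filter_mono nhdsWithin_le_nhds, hne.filter_mono nhdsWithin_le_nhds,
        self_mem_nhdsWithin] with t h1 h2 h3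
      have h4 := hCW h3
      simp only [sub_zero, smul_eq_mul] at h1
      simp only [hC] at h4
      rw [h1] at h4
      rw [Pi.div_apply, ← h4]
      field_simp) (by
      filter_upwards [self_mem_nhdsWithin] with t ht
      rw [abs_of_nonneg mgf_nonneg]
      have hti : t ∈ integrableExpSet X μ := interior_subset (hsub ht)
      refine integral_mono hti (by simp) fun ω => ?_
      simp only [zero_mul]
      exact Real.exp_le_exp.2 (mul_nonpos_of_nonpos_of_nonneg (le_of_lt ht) (hX0 ω)))
  exact exists_integrable_exp_mul_of_analyticAt hX hX0 hg hg'

end ProbabilityTheory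

/-! ### A difference equation for the integrals of a family of powers -/

/-- More than `(D + 1) ^ N` polynomials of degree at most `D` in `N` variables are linearly
dependent. -/
theorem MvPolynomial.exists_relation_of_totalDegree_le {A κ : Type*} [CommRing A] [Nontrivial A]
    [Fintype κ] {N D : ℕ} (v : κ → MvPolynomial (Fin N) A) (hv : ∀ k, (v k).totalDegree ≤ D)
    (hcard : (D + 1) ^ N < Fintype.card κ) :
    ∃ g : κ → A, ∑ k, g k • v k = 0 ∧ ∃ k, g k ≠ 0 := by
  classical
  let w : κ → (Fin N → Fin (D + 1)) → A := fun k γ =>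
    coeff (Finsupp.equivFunOnFinite.symm fun i => (γ i : ℕ)) (v k)
  have hw : ¬ LinearIndependent A w := fun h => by
    have := h.fintype_card_le_finrank
    rw [Module.finrank_fintype_fun_eq_card, Fintype.card_fun, Fintype.card_fin,
      Fintype.card_fin] at this
    omega
  obtain ⟨g, hg, k, hk⟩ := Fintype.not_linearIndependent_iff.1 hw
  refine ⟨g, ?_, k, hk⟩
  ext m
  rw [coeff_sum, coeff_zero]
  simp only [coeff_smul]
  by_cases hm : ∀ i, m i < D + 1
  · have h := congrFun hg fun i => ⟨m i, hm i⟩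
    have hm' : (Finsupp.equivFunOnFinite.symm fun i => m i) = m := by ext; simp
    simpa [w, Finset.sum_apply, hm'] using h
  · push Not at hm
    obtain ⟨i, hi⟩ := hm
    refine Finset.sum_eq_zero fun k _ => ?_
    rw [coeff_eq_zero_of_totalDegree_lt, smul_zero]
    refine (hv k).trans_lt (hi.trans ?_)
    by_cases hmi : i ∈ m.support
    · exact Finset.single_le_sum (f := fun i => m i) (fun _ _ => Nat.zero_le _) hmi
    · rw [Finsupp.notMem_support_iff.1 hmi] at hi
      omega

namespace RealPolynomial

variable {N : ℕ}

/-- Evaluation of a polynomial in `x` whose coefficients are polynomials in a parameter `t`. -/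
noncomputable def evalAt (t : ℝ) (x : Fin N → ℝ) : MvPolynomial (Fin N) (Polynomial ℝ) →+* ℝ :=
  (eval x).comp (map (Polynomial.evalRingHom t))

theorem evalAt_smul (t : ℝ) (x : Fin N → ℝ) (a : Polynomial ℝ)
    (p : MvPolynomial (Fin N) (Polynomial ℝ)) : evalAt t x (a • p) = a.eval t * evalAt t x p := by
  simp [evalAt, smul_eq_C_mul]

theorem evalAt_map_C (t : ℝ) (x : Fin N → ℝ) (p : MvPolynomial (Fin N) ℝ) :
    evalAt t x (map Polynomial.C p) = eval x p := by
  have : (Polynomial.evalRingHom t).comp Polynomial.C = RingHom.id ℝ := by ext; simp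
  rw [evalAt, RingHom.comp_apply, MvPolynomial.map_map, this, MvPolynomial.map_id]

theorem hasLineDerivAt_evalAt (t : ℝ) (p : MvPolynomial (Fin N) (Polynomial ℝ)) (j : Fin N)
    (x : Fin N → ℝ) : HasLineDerivAt ℝ (fun x => evalAt t x p) (evalAt t x (pderiv j p)) x
      (Pi.single j 1) := by
  have := hasLineDerivAt_eval (map (Polynomial.evalRingHom t) p) j x
  rwa [pderiv_map] at this

/-- The model is a family of functions `F t = f * Q ^ t` on `ℝ ^ N`, for a polynomial `Q`, whose
logarithmic derivatives are rational functions of `x` and `t` with the denominator `den`. Of the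
dependence on `t` only the relation `F (t - i) = Q ^ (-i) * F t` for natural numbers `i` is
recorded, with `1 / Q` written as `shift / den`. A polynomial multiple of `F t` is required to
become integrable when `t` is near `-∞`. -/
structure PowerFamily (N : ℕ) where
  /-- The members of the family. -/
  F : ℝ → (Fin N → ℝ) → ℝ
  /-- The common denominator. -/
  den : MvPolynomial (Fin N) ℝ
  /-- The numerators of the logarithmic derivatives. -/
  num : Fin N → MvPolynomial (Fin N) (Polynomial ℝ)
  /-- The numerator of `1 / Q`. -/
  shift : MvPolynomial (Fin N) ℝ
  den_ne_zero : ∀ x, eval x den ≠ 0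
  hasLineDerivAt : ∀ t j x,
    HasLineDerivAt ℝ (F t) (evalAt t x (num j) / eval x den * F t x) x (Pi.single j 1)
  integrable : ∀ (p : MvPolynomial (Fin N) (Polynomial ℝ)) (k : ℕ),
    ∀ᶠ t in atBot, Integrable fun x => evalAt t x p / eval x den ^ k * F t x
  F_sub_natCast : ∀ t (i : ℕ) x, F (t - i) x = (eval x shift / eval x den) ^ i * F t x

namespace PowerFamily

variable (W : PowerFamily N)

/-- The denominator, seen as a polynomial whose coefficients are constant in the parameter. -/
noncomputable def den' : MvPolynomial (Fin N) (Polynomial ℝ) := map Polynomial.C W.den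

/-- The integral of `p / den ^ k * F t`. -/
noncomputable def J (t : ℝ) (k : ℕ) (p : MvPolynomial (Fin N) (Polynomial ℝ)) : ℝ :=
  ∫ x, evalAt t x p / eval x W.den ^ k * W.F t x

/-- The numerator over `den ^ (k + 1)` of the partial derivative of `p / den ^ k * F t`, divided by
`F t`. -/
noncomputable def opD (j : Fin N) (k : ℕ) (p : MvPolynomial (Fin N) (Polynomial ℝ)) :
    MvPolynomial (Fin N) (Polynomial ℝ) :=
  W.den' * pderiv j p - (k : MvPolynomial (Fin N) (Polynomial ℝ)) * pderiv j W.den' * p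
    + W.num j * p

theorem evalAt_den' (t : ℝ) (x : Fin N → ℝ) : evalAt t x W.den' = eval x W.den :=
  evalAt_map_C t x _

theorem hasLineDerivAt_div_den_pow (t : ℝ) (k : ℕ) (p : MvPolynomial (Fin N) (Polynomial ℝ))
    (j : Fin N) (x : Fin N → ℝ) :
    HasLineDerivAt ℝ (fun x => evalAt t x p / eval x W.den ^ k * W.F t x)
      (evalAt t x (W.opD j k p) / eval x W.den ^ (k + 1) * W.F t x) x (Pi.single j 1) := by
  have hp := hasLineDerivAt_evalAt t p j x
  have hd := hasLineDerivAt_evalAt t W.den' j x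
  have hF := W.hasLineDerivAt t j x
  simp only [evalAt_den'] at hd
  have h0 : eval (x + (0 : ℝ) • Pi.single j (1 : ℝ)) W.den ^ k ≠ 0 :=
    pow_ne_zero _ (W.den_ne_zero _)
  unfold HasLineDerivAt at hp hd hF ⊢
  have h := (hp.fun_div (hd.fun_pow k) h0).fun_mul hF
  refine h.congr_deriv ?_
  simp only [zero_smul, add_zero]
  have h1 := W.den_ne_zero x
  simp only [opD, map_add, map_sub, map_mul, evalAt_den', map_natCast]
  rcases k with _ | k
  · field_simp
    ring
  · rw [Nat.add_sub_cancel]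
    field_simp
    ring

theorem J_mul_opD (q p : MvPolynomial (Fin N) (Polynomial ℝ)) (j : Fin N) (k : ℕ) :
    ∀ᶠ t in atBot, W.J t (k + 1) (q * W.opD j k p) = -W.J t k (pderiv j q * p) := by
  filter_upwards [W.integrable (q * p) k, W.integrable (W.opD j k (q * p)) (k + 1),
    W.integrable (q * W.opD j k p) (k + 1), W.integrable (pderiv j q * p) k] with t h1 h2 h3 h4
  have h := integral_bilinear_hasLineDerivAt_right_eq_neg_left_of_integrable
    (μ := (volume : Measure (Fin N → ℝ))) (f := fun _ => (1 : ℝ)) (f' := fun _ => 0)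
    (g := fun x => evalAt t x (q * p) / eval x W.den ^ k * W.F t x)
    (g' := fun x => evalAt t x (W.opD j k (q * p)) / eval x W.den ^ (k + 1) * W.F t x)
    (v := Pi.single j 1) (B := ContinuousLinearMap.mul ℝ ℝ) (by simp) (by simpa using h2)
    (by simpa using h1)
    (fun x _ => by simpa [HasLineDerivAt] using hasDerivAt_const (0 : ℝ) (1 : ℝ))
    (fun x _ => W.hasLineDerivAt_div_den_pow t k (q * p) j x)
  simp only [ContinuousLinearMap.mul_apply', one_mul, zero_mul, integral_zero, neg_zero] at h
  rw [J, J, eq_neg_iff_add_eq_zero, ← integral_add h3 h4, ← h]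
  refine integral_congr_ae (ae_of_all _ fun x => ?_)
  have h1 := W.den_ne_zero x
  simp only [opD, pderiv_mul, map_add, map_sub, map_mul, evalAt_den', map_natCast]
  field_simp
  ring

theorem J_natCast_mul (t : ℝ) (k n : ℕ) (p : MvPolynomial (Fin N) (Polynomial ℝ)) :
    W.J t k (n * p) = n * W.J t k p := by
  rw [J, J, ← integral_const_mul]
  congr 1 with x
  rw [map_mul, map_natCast]
  ring

theorem J_mul_den'_pow (t : ℝ) (k n : ℕ) (p : MvPolynomial (Fin N) (Polynomial ℝ)) :
    W.J t (k + n) (W.den' ^ n * p) = W.J t k p := by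
  rw [J, J]
  congr 1 with x
  have h1 := W.den_ne_zero x
  rw [map_mul, map_pow, evalAt_den']
  field_simp
  ring

theorem J_shift_pow (t : ℝ) (i : ℕ) :
    W.J t i (map Polynomial.C W.shift ^ i) = ∫ x, W.F (t - i) x := by
  rw [J]
  congr 1 with x
  rw [W.F_sub_natCast, map_pow, evalAt_map_C, div_pow]

theorem J_sum {κ : Type*} (s : Finset κ) (k : ℕ) (g : κ → Polynomial ℝ)
    (p : κ → MvPolynomial (Fin N) (Polynomial ℝ)) :
    ∀ᶠ t in atBot, W.J t k (∑ i ∈ s, g i • p i) = ∑ i ∈ s, (g i).eval t * W.J t k (p i) := by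
  have h : ∀ᶠ t in atBot, ∀ i ∈ s,
      Integrable fun x => evalAt t x (p i) / eval x W.den ^ k * W.F t x :=
    (Finset.eventually_all s).2 fun i _ => W.integrable (p i) k
  filter_upwards [h] with t ht
  simp only [J, ← integral_const_mul]
  rw [← integral_finsetSum _ fun i hi => (ht i hi).const_mul _]
  congr 1 with x
  rw [map_sum, Finset.sum_div, Finset.sum_mul]
  refine Finset.sum_congr rfl fun i _ => ?_
  rw [evalAt_smul]
  ring

/-- A bound for the degrees of `den`, `shift` and all the `num j`. -/
noncomputable def degBound : ℕ :=
  W.den.totalDegree + W.shift.totalDegree + ∑ j, (W.num j).totalDegree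

theorem totalDegree_map_C_le (p : MvPolynomial (Fin N) ℝ) :
    (map (Polynomial.C : ℝ →+* Polynomial ℝ) p).totalDegree ≤ p.totalDegree :=
  Finset.sup_mono (support_map_subset _ _)

theorem totalDegree_den'_le : W.den'.totalDegree ≤ W.degBound :=
  (totalDegree_map_C_le _).trans (by rw [degBound]; omega)

theorem totalDegree_opD_le (j : Fin N) (k : ℕ) (p : MvPolynomial (Fin N) (Polynomial ℝ)) :
    (W.opD j k p).totalDegree ≤ p.totalDegree + W.degBound := by
  have hnum : (W.num j).totalDegree ≤ W.degBound := by
    have := Finset.single_le_sum (f := fun j => (W.num j).totalDegree) (fun _ _ => Nat.zero_le _)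
      (Finset.mem_univ j)
    rw [degBound]
    omega
  have hden := W.totalDegree_den'_le
  have h1 := totalDegree_mul W.den' (pderiv j p)
  have h2 := totalDegree_pderiv_le p j
  have h3 := totalDegree_mul ((k : MvPolynomial (Fin N) (Polynomial ℝ)) * pderiv j W.den') p
  have h4 := totalDegree_mul (k : MvPolynomial (Fin N) (Polynomial ℝ)) (pderiv j W.den')
  have h5 : (k : MvPolynomial (Fin N) (Polynomial ℝ)).totalDegree = 0 := by
    rw [← map_natCast C, totalDegree_C]
  have h6 := totalDegree_pderiv_le W.den' j
  have h7 := totalDegree_mul (W.num j) p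
  refine (totalDegree_add _ _).trans (max_le ((totalDegree_sub _ _).trans (max_le ?_ ?_)) ?_) <;>
  omega

/-- The function `∂ ^ α (F (t - i))` has the form `p / den ^ (|α| + i) * F t` with a polynomial `p`
whose degree is bounded linearly in `|α| + i`. Only the consequence for integrals against
monomials is recorded: `∂ ^ α` kills `x ^ β` unless `α ≤ β`, and maps `x ^ α` to a constant. -/
theorem exists_iterated_derivative (i : ℕ) (n : ℕ) : ∀ α : Fin N →₀ ℕ, α.degree = n →
    ∃ p : MvPolynomial (Fin N) (Polynomial ℝ), p.totalDegree ≤ W.degBound * (n + i) ∧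
      (∀ β : Fin N →₀ ℕ, (∃ j, β j < α j) →
        ∀ᶠ t in atBot, W.J t (n + i) (monomial β 1 * p) = 0) ∧
      ∃ κ : ℝ, κ ≠ 0 ∧ ∀ᶠ t in atBot,
        W.J t (n + i) (monomial α 1 * p) = κ * ∫ x, W.F (t - i) x := by
  induction n with
  | zero =>
    intro α hα
    have hα0 : α = 0 := by rwa [Finsupp.degree_eq_zero_iff] at hα
    subst hα0
    refine ⟨map Polynomial.C W.shift ^ i, ?_, ?_, 1, one_ne_zero, Eventually.of_forall fun t => ?_⟩
    · refine (totalDegree_pow _ _).trans ?_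
      rw [zero_add, mul_comm]
      refine Nat.mul_le_mul_right _ ((totalDegree_map_C_le _).trans ?_)
      rw [degBound]
      omega
    · rintro β ⟨j, hj⟩
      simp at hj
    · rw [← C_apply, C_1, one_mul, one_mul, zero_add, J_shift_pow]
  | succ n ih =>
    intro α hα
    obtain ⟨j, hj⟩ : ∃ j, α j ≠ 0 := by
      by_contra! h0
      have : α = 0 := Finsupp.ext h0
      simp [this] at hα
    have hle : Finsupp.single j 1 ≤ α := by
      rw [Finsupp.single_le_iff]
      omega
    have hsplit : α - Finsupp.single j 1 + Finsupp.single j 1 = α := tsub_add_cancel_of_le hle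
    have hdeg : (α - Finsupp.single j 1).degree = n := by
      have := congrArg Finsupp.degree hsplit
      rw [map_add, Finsupp.degree_single] at this
      omega
    obtain ⟨p, hp, hp0, κ, hκ, hpκ⟩ := ih _ hdeg
    have hidx : n + 1 + i = n + i + 1 := by omega
    have hstep (β : Fin N →₀ ℕ) : ∀ᶠ t in atBot,
        W.J t (n + 1 + i) (monomial β 1 * W.opD j (n + i) p)
          = -(β j * W.J t (n + i) (monomial (β - Finsupp.single j 1) 1 * p)) := by
      filter_upwards [W.J_mul_opD (monomial β 1) p j (n + i)] with t ht
      rw [hidx, ht, pderiv_monomial, one_mul, ← J_natCast_mul, ← mul_assoc, ← map_natCast C,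
        C_mul_monomial, mul_one]
    refine ⟨W.opD j (n + i) p, ?_, ?_, -(α j * κ), ?_, ?_⟩
    · have := W.totalDegree_opD_le j (n + i) p
      rw [hidx, mul_add, mul_one]
      omega
    · rintro β ⟨l, hl⟩
      by_cases hβ : β j = 0
      · filter_upwards [hstep β] with t ht
        rw [ht, hβ, Nat.cast_zero, zero_mul, neg_zero]
      · have hlt : (β - Finsupp.single j 1 : Fin N →₀ ℕ) l
            < (α - Finsupp.single j 1 : Fin N →₀ ℕ) l := by
          rw [Finsupp.tsub_apply, Finsupp.tsub_apply]
          rcases eq_or_ne l j with rfl | hlj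
          · rw [Finsupp.single_eq_same]
            omega
          · rw [Finsupp.single_eq_of_ne hlj]
            omega
        filter_upwards [hstep β, hp0 _ ⟨l, hlt⟩] with t ht ht0
        rw [ht, ht0, mul_zero, neg_zero]
    · simp [hj, hκ]
    · filter_upwards [hstep α, hpκ] with t ht ht0
      rw [ht, ht0]
      ring

/-- The integrals of a power family satisfy a linear difference equation with polynomial
coefficients. The functions `∂ ^ α (F (t - i))` with `α j ≤ T` and `i ≤ T` are too many to be
linearly independent over the polynomials in `t`. The equation results from the integration of a
linear relation against `x ^ β`, where `β` is an exponent of minimal degree that occurs in it. -/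
theorem exists_recurrence : ∃ (n : ℕ) (c : ℕ → Polynomial ℝ), (∃ i < n, c i ≠ 0) ∧
    ∀ᶠ t in atBot, ∑ i ∈ Finset.range n, (c i).eval t * ∫ x, W.F (t - i) x = 0 := by
  classical
  -- With `α j ≤ T` and `i ≤ T` there are `(T + 1) ^ (N + 1)` derivatives, whose numerators over
  -- `den ^ ((N + 1) * T)` lie in a space of rank `(D + 1) ^ N ≤ (b * (T + 1)) ^ N`. The choice
  -- `T = b ^ N` makes the former number larger.
  set b := W.degBound * (N + 1) + 1 with hb
  set T := b ^ N with hT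
  set D := W.degBound * ((N + 1) * T) with hD
  let α : (Fin N → Fin (T + 1)) → Fin N →₀ ℕ := fun a =>
    Finsupp.equivFunOnFinite.symm fun i => (a i : ℕ)
  have hαinj : Function.Injective α := fun a a' h => by
    funext i
    have := DFunLike.congr_fun h i
    exact Fin.ext this
  choose p hp hp0 κ hκ hpκ using fun k : (Fin N → Fin (T + 1)) × Fin (T + 1) =>
    W.exists_iterated_derivative k.2 _ (α k.1) rfl
  set e : (Fin N → Fin (T + 1)) × Fin (T + 1) → ℕ := fun k => (α k.1).degree + k.2 with he
  have heT (k) : e k ≤ (N + 1) * T := by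
    have h1 : (α k.1).degree ≤ N * T := by
      rw [Finsupp.degree_eq_sum]
      refine (Finset.sum_le_card_nsmul Finset.univ _ T fun i _ => ?_).trans (by simp)
      exact Nat.lt_succ_iff.1 (k.1 i).2
    have h2 : (k.2 : ℕ) ≤ T := Nat.lt_succ_iff.1 k.2.2
    simp only [he]
    linarith
  obtain ⟨g, hg, k₁, hk₁⟩ := MvPolynomial.exists_relation_of_totalDegree_le
    (fun k => W.den' ^ ((N + 1) * T - e k) * p k) (D := D) (fun k => by
      refine (totalDegree_mul _ _).trans ?_
      have h1 := totalDegree_pow W.den' ((N + 1) * T - e k)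
      have h2 := Nat.mul_le_mul_left ((N + 1) * T - e k) W.totalDegree_den'_le
      have h3 := hp k
      have h4 : ((N + 1) * T - e k) * W.degBound + W.degBound * e k = D := by
        rw [mul_comm, ← mul_add, Nat.sub_add_cancel (heT k)]
      simp only [he] at h1 h2 h4 ⊢
      omega) (by
      rw [Fintype.card_prod, Fintype.card_fun, Fintype.card_fin, Fintype.card_fin]
      calc (D + 1) ^ N ≤ (b * (T + 1)) ^ N := by
            refine Nat.pow_le_pow_left ?_ _
            rw [hD, hb]
            nlinarith
        _ = (T + 1) ^ N * T := by rw [mul_pow, hT, mul_comm]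
        _ < (T + 1) ^ N * (T + 1) := by
            exact Nat.mul_lt_mul_of_pos_left (Nat.lt_succ_self T) (by positivity))
  obtain ⟨k₀, hk₀, hmin⟩ := Finset.exists_min_image (Finset.univ.filter fun k => g k ≠ 0)
    (fun k => (α k.1).degree) ⟨k₁, by simpa using hk₁⟩
  have hk₀' : g k₀ ≠ 0 := (Finset.mem_filter.1 hk₀).2
  set a₀ := k₀.1 with ha₀
  have hterm : ∀ᶠ t in atBot, ∀ k ∈ Finset.univ, (g k).eval t * W.J t (e k)
      (monomial (α a₀) 1 * p k) = if k.1 = a₀ then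
        (g k).eval t * (κ k * ∫ x, W.F (t - (k.2 : ℕ)) x) else 0 := by
    refine (Finset.eventually_all _).2 fun k _ => ?_
    split_ifs with hk
    · filter_upwards [hpκ k] with t ht
      rw [← hk, ← ht]
    · by_cases hgk : g k = 0
      · simp [hgk]
      · have hdeg := hmin k (by simpa using hgk)
        -- an exponent different from `α a₀` and of no smaller degree is not below `α a₀`
        obtain ⟨j, hj⟩ : ∃ j, (α a₀) j < (α k.1) j := by
          by_contra! hle
          have hle' : α k.1 ≤ α a₀ := hle
          have h1 := congrArg Finsupp.degree (tsub_add_cancel_of_le hle')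
          rw [map_add] at h1
          have h2 : (α a₀ - α k.1).degree = 0 := by omega
          rw [Finsupp.degree_eq_zero_iff, tsub_eq_zero_iff_le] at h2
          exact hk (hαinj (le_antisymm hle' h2))
        filter_upwards [hp0 k (α a₀) ⟨j, hj⟩] with t ht
        rw [ht, mul_zero]
  refine ⟨T + 1, fun i => if h : i < T + 1 then Polynomial.C (κ (a₀, ⟨i, h⟩)) * g (a₀, ⟨i, h⟩)
    else 0, ⟨k₀.2, k₀.2.2, ?_⟩, ?_⟩
  · simp only [Fin.is_lt, dite_true]
    exact mul_ne_zero (Polynomial.C_ne_zero.2 (hκ _)) hk₀'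
  · filter_upwards [hterm, W.J_sum Finset.univ ((N + 1) * T) g fun k =>
      monomial (α a₀) 1 * (W.den' ^ ((N + 1) * T - e k) * p k)] with t h1 h2
    have h3 : ∑ k, g k • (monomial (α a₀) 1 * (W.den' ^ ((N + 1) * T - e k) * p k)) = 0 := by
      rw [← mul_zero (monomial (α a₀) 1), ← hg, Finset.mul_sum]
      exact Finset.sum_congr rfl fun k _ => (mul_smul_comm _ _ _).symm
    have h4 (k) : W.J t ((N + 1) * T)
        (monomial (α a₀) 1 * (W.den' ^ ((N + 1) * T - e k) * p k))
          = W.J t (e k) (monomial (α a₀) 1 * p k) := by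
      rw [mul_left_comm, ← W.J_mul_den'_pow t (e k) ((N + 1) * T - e k),
        Nat.add_sub_cancel' (heT k)]
    rw [h3, Finset.sum_congr rfl fun k hk => by rw [h4 k, h1 k hk], Fintype.sum_prod_type,
      Finset.sum_eq_single a₀ (fun a _ ha => by simp [ha]) (by simp)] at h2
    rw [Finset.sum_range]
    have h0 : W.J t ((N + 1) * T) 0 = 0 := by simp [J]
    rw [h0] at h2
    rw [h2]
    refine Finset.sum_congr rfl fun i _ => ?_
    simp only [Fin.is_lt, dite_true, if_true, Fin.eta, Polynomial.eval_mul, Polynomial.eval_C]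
    ring

end PowerFamily

end RealPolynomial

/-! ### The set of exponents of integrability is open -/

namespace RealPolynomial

variable {N : ℕ} {ι : Type*} [Fintype ι]

/-- The logarithm `∑ l, σ l * log (P l x)` of the product of the powers `P l x ^ σ l`. -/
noncomputable def logProd (P : ι → MvPolynomial (Fin N) ℝ) (σ : ι → ℝ) (x : Fin N → ℝ) : ℝ :=
  ∑ l, σ l * Real.log (eval x (P l))

variable {P : ι → MvPolynomial (Fin N) ℝ}

theorem continuous_log_eval {p : MvPolynomial (Fin N) ℝ} (hp : ∀ x, 0 < eval x p) :
    Continuous fun x => Real.log (eval x p) :=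
  (MvPolynomial.continuous_eval p).log fun x => (hp x).ne'

theorem continuous_logProd (hP : ∀ l x, 0 < eval x (P l)) (σ : ι → ℝ) :
    Continuous (logProd P σ) :=
  continuous_finsetSum _ fun l _ => (continuous_log_eval (hP l)).const_mul (σ l)

theorem hasLineDerivAt_log_eval {p : MvPolynomial (Fin N) ℝ} (hp : ∀ x, 0 < eval x p) (j : Fin N)
    (x : Fin N → ℝ) : HasLineDerivAt ℝ (fun x => Real.log (eval x p))
      (eval x (pderiv j p) / eval x p) x (Pi.single j 1) := by
  have h := hasLineDerivAt_eval p j x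
  unfold HasLineDerivAt at h ⊢
  simpa using h.log (by simpa using (hp x).ne')

theorem hasLineDerivAt_logProd (hP : ∀ l x, 0 < eval x (P l)) (σ : ι → ℝ) (j : Fin N)
    (x : Fin N → ℝ) : HasLineDerivAt ℝ (logProd P σ)
      (∑ l, σ l * (eval x (pderiv j (P l)) / eval x (P l))) x (Pi.single j 1) :=
  HasDerivAt.fun_sum fun l _ => (hasLineDerivAt_log_eval (hP l) j x).const_mul (σ l)

/-- The family of the functions `∏ l, P l ^ σ l * Q ^ t`. -/
noncomputable def powerFamily (hP : ∀ l, Tame (P l)) (σ : ι → ℝ)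
    (hint : Integrable fun x => Real.exp (logProd P σ x)) (Q : MvPolynomial (Fin N) ℝ)
    (hQ1 : ∀ x, 1 ≤ eval x Q) (hQ : ∃ c, 0 < c ∧ ∀ x : Fin N → ℝ, c * (1 + ‖x‖) ≤ eval x Q) :
    PowerFamily N where
  F t x := Real.exp (logProd P σ x + t * Real.log (eval x Q))
  den := Q * ∏ l, P l
  num j := by
    classical
    exact MvPolynomial.map Polynomial.C
      (∑ l, C (σ l) * (pderiv j (P l) * (Q * ∏ i ∈ Finset.univ.erase l, P i)))
      + C Polynomial.X * MvPolynomial.map Polynomial.C (pderiv j Q * ∏ l, P l)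
  shift := ∏ l, P l
  den_ne_zero x := by
    rw [map_mul, map_prod]
    exact mul_ne_zero (zero_lt_one.trans_le (hQ1 x)).ne'
      (Finset.prod_ne_zero_iff.2 fun l _ => ((hP l).pos x).ne')
  hasLineDerivAt t j x := by
    classical
    have hQ0 (x) : 0 < eval x Q := zero_lt_one.trans_le (hQ1 x)
    have h1 := hasLineDerivAt_logProd (fun l => (hP l).pos) σ j x
    have h2 := hasLineDerivAt_log_eval hQ0 j x
    unfold HasLineDerivAt at h1 h2 ⊢
    refine (h1.fun_add (h2.const_mul t)).exp.congr_deriv ?_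
    rw [zero_smul, add_zero, mul_comm]
    congr 1
    have hprod (l) : ∏ i, eval x (P i)
        = eval x (P l) * ∏ i ∈ Finset.univ.erase l, eval x (P i) :=
      (Finset.mul_prod_erase _ _ (Finset.mem_univ l)).symm
    have h3 : evalAt t x (C Polynomial.X) = t := by simp [evalAt]
    have hne : ∏ l, eval x (P l) ≠ 0 :=
      Finset.prod_ne_zero_iff.2 fun l _ => ((hP l).pos x).ne'
    rw [map_add, map_mul, h3, evalAt_map_C, evalAt_map_C]
    simp only [map_sum, map_mul, map_prod, eval_C]
    rw [add_div, Finset.sum_div]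
    congr 1
    · refine Finset.sum_congr rfl fun l _ => ?_
      have hl := ((hP l).pos x).ne'
      have hl2 : ∏ i ∈ Finset.univ.erase l, eval x (P i) ≠ 0 :=
        Finset.prod_ne_zero_iff.2 fun l _ => ((hP l).pos x).ne'
      have hq := (hQ0 x).ne'
      rw [hprod l]
      field_simp
    · have hq := (hQ0 x).ne'
      field_simp
  integrable p k := by
    have hQ0 (x) : 0 < eval x Q := zero_lt_one.trans_le (hQ1 x)
    obtain ⟨c, hc, hcQ⟩ := hQ
    choose b hb hbP using fun l => (hP l).exists_pos_le
    have hden (x : Fin N → ℝ) : ∏ l, b l ≤ eval x (Q * ∏ l, P l) := by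
      rw [map_mul, map_prod]
      refine (Finset.prod_le_prod (fun l _ => (hb l).le) fun l _ => hbP l x).trans ?_
      exact le_mul_of_one_le_left (Finset.prod_nonneg fun l _ => ((hP l).pos x).le) (hQ1 x)
    have hb0 : 0 < ∏ l, b l := Finset.prod_pos fun l _ => hb l
    filter_upwards [eventually_le_atBot (-(p.totalDegree : ℝ))] with t ht
    obtain ⟨B, hB, hBp⟩ := abs_eval_le (MvPolynomial.map (Polynomial.evalRingHom t) p)
      (m := p.totalDegree) (Finset.sup_mono (support_map_subset _ _))
    have hcont : Continuous fun x => evalAt t x p / eval x (Q * ∏ l, P l) ^ k *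
        Real.exp (logProd P σ x + t * Real.log (eval x Q)) := by
      refine Continuous.mul (Continuous.div (MvPolynomial.continuous_eval _)
        ((MvPolynomial.continuous_eval _).pow _)
        fun x => (pow_pos (hb0.trans_le (hden x)) _).ne') ?_
      exact ((continuous_logProd (fun l => (hP l).pos) σ).add
        ((continuous_log_eval hQ0).const_mul t)).rexp
    refine Integrable.mono' (hint.const_mul (B / c ^ p.totalDegree / (∏ l, b l) ^ k))
      hcont.aestronglyMeasurable (ae_of_all _ fun x => ?_)
    have hx : 0 < 1 + ‖x‖ := by positivity
    have h1 : Real.exp (t * Real.log (eval x Q)) ≤ 1 / (c * (1 + ‖x‖)) ^ p.totalDegree := by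
      calc Real.exp (t * Real.log (eval x Q))
          ≤ Real.exp (-(p.totalDegree : ℝ) * Real.log (eval x Q)) := by
            refine Real.exp_le_exp.2 ?_
            exact mul_le_mul_of_nonneg_right ht (Real.log_nonneg (hQ1 x))
        _ = 1 / eval x Q ^ p.totalDegree := by
            rw [neg_mul, Real.exp_neg, Real.exp_nat_mul, Real.exp_log (hQ0 x), one_div]
        _ ≤ _ := by
            refine one_div_le_one_div_of_le (by positivity) ?_
            exact pow_le_pow_left₀ (by positivity) (hcQ x) _
    have h2 : 0 < eval x (Q * ∏ l, P l) := hb0.trans_le (hden x)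
    rw [norm_mul, norm_div, norm_pow, Real.norm_eq_abs, Real.norm_eq_abs, abs_of_pos h2,
      Real.norm_eq_abs, Real.abs_exp, Real.exp_add]
    calc |evalAt t x p| / eval x (Q * ∏ l, P l) ^ k *
          (Real.exp (logProd P σ x) * Real.exp (t * Real.log (eval x Q)))
        ≤ (B * (1 + ‖x‖) ^ p.totalDegree) / (∏ l, b l) ^ k *
          (Real.exp (logProd P σ x) * (1 / (c * (1 + ‖x‖)) ^ p.totalDegree)) := by
          gcongr
          · exact hBp x
          · exact hden x
      _ = _ := by
          rw [mul_pow]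
          field_simp
  F_sub_natCast t i x := by
    have hQ0 : 0 < eval x Q := zero_lt_one.trans_le (hQ1 x)
    have h1 : eval x (∏ l, P l) ≠ 0 := by
      rw [map_prod]
      exact Finset.prod_ne_zero_iff.2 fun l _ => ((hP l).pos x).ne'
    have h2 : eval x (∏ l, P l) / eval x (Q * ∏ l, P l) = Real.exp (-Real.log (eval x Q)) := by
      rw [Real.exp_neg, Real.exp_log hQ0, map_mul]
      field_simp
    rw [h2, ← Real.exp_nat_mul, ← Real.exp_add]
    congr 1
    ring

/-- An integrable product of real powers of tame polynomials remains integrable after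
multiplication by a small positive power of a polynomial `Q`. -/
theorem exists_integrable_exp_logProd_add (hP : ∀ l, Tame (P l)) (σ : ι → ℝ)
    (hint : Integrable fun x => Real.exp (logProd P σ x)) (Q : MvPolynomial (Fin N) ℝ)
    (hQ1 : ∀ x, 1 ≤ eval x Q) (hQ : ∃ c, 0 < c ∧ ∀ x : Fin N → ℝ, c * (1 + ‖x‖) ≤ eval x Q) :
    ∃ δ > 0, Integrable fun x => Real.exp (logProd P σ x + δ * Real.log (eval x Q)) := by
  have hcont := continuous_logProd (fun l => (hP l).pos) σ
  have hQcont := continuous_log_eval fun x => zero_lt_one.trans_le (hQ1 x)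
  set μ : Measure (Fin N → ℝ) := volume.withDensity fun x => ENNReal.ofReal
    (Real.exp (logProd P σ x)) with hμ
  have hmeas : Measurable fun x => ENNReal.ofReal (Real.exp (logProd P σ x)) :=
    hcont.rexp.measurable.ennreal_ofReal
  have hfin : IsFiniteMeasure μ := isFiniteMeasure_withDensity_ofReal hint.2
  have hmgf (t : ℝ) : ProbabilityTheory.mgf (fun x => Real.log (eval x Q)) μ t
      = ∫ x, Real.exp (logProd P σ x + t * Real.log (eval x Q)) := by
    rw [ProbabilityTheory.mgf, hμ, integral_withDensity_eq_integral_toReal_smul hmeas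
      (ae_of_all _ fun x => ENNReal.ofReal_lt_top)]
    congr 1 with x
    rw [ENNReal.toReal_ofReal (Real.exp_pos _).le, Real.exp_add, smul_eq_mul]
  obtain ⟨n, c, hc, hrec⟩ := (powerFamily hP σ hint Q hQ1 hQ).exists_recurrence
  obtain ⟨δ, hδ, h⟩ := ProbabilityTheory.exists_integrable_exp_mul_of_recurrence (μ := μ)
    hQcont.measurable (fun x => Real.log_nonneg (hQ1 x)) c hc (by
      simp only [hmgf]
      exact hrec)
  refine ⟨δ, hδ, ?_⟩
  rw [hμ, integrable_withDensity_iff_integrable_smul' hmeas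
    (ae_of_all _ fun x => ENNReal.ofReal_lt_top)] at h
  refine h.congr (ae_of_all _ fun x => ?_)
  simp only [ENNReal.toReal_ofReal (Real.exp_pos _).le, Real.exp_add, smul_eq_mul]

end RealPolynomial

namespace RealPolynomial

variable {N : ℕ} {ι : Type*} [Fintype ι] {P : ι → MvPolynomial (Fin N) ℝ}

theorem Tame.abs_log_le {p Q : MvPolynomial (Fin N) ℝ} (hp : Tame p) (hQ1 : ∀ x, 1 ≤ eval x Q)
    (hQ : ∃ c, 0 < c ∧ ∀ x : Fin N → ℝ, c * (1 + ‖x‖) ≤ eval x Q) :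
    ∃ A, 0 ≤ A ∧ ∀ x : Fin N → ℝ, |Real.log (eval x p)| ≤ A * (1 + Real.log (eval x Q)) := by
  obtain ⟨b, hb, hbp⟩ := hp.exists_pos_le
  obtain ⟨c, hc, hcQ⟩ := hQ
  obtain ⟨C, hC, hCp⟩ := abs_eval_le p le_rfl
  set m := p.totalDegree
  refine ⟨|Real.log b| + |Real.log (C / c ^ m)| + m, by positivity, fun x => ?_⟩
  have hq := Real.log_nonneg (hQ1 x)
  have hQ0 : 0 < eval x Q := zero_lt_one.trans_le (hQ1 x)
  have hp0 := hp.pos x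
  have h1 : Real.log b ≤ Real.log (eval x p) := Real.log_le_log hb (hbp x)
  have h2 : eval x p ≤ C / c ^ m * eval x Q ^ m := by
    calc eval x p ≤ C * (1 + ‖x‖) ^ m := (le_abs_self _).trans (hCp x)
      _ = C / c ^ m * (c * (1 + ‖x‖)) ^ m := by rw [mul_pow]; field_simp
      _ ≤ _ := by
        refine mul_le_mul_of_nonneg_left ?_ (by positivity)
        exact pow_le_pow_left₀ (by positivity) (hcQ x) _
  have h3 : Real.log (eval x p) ≤ Real.log (C / c ^ m) + m * Real.log (eval x Q) := by
    have hne : C / c ^ m ≠ 0 := fun h0 => by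
      rw [h0, zero_mul] at h2
      linarith
    rw [← Real.log_pow, ← Real.log_mul hne (by positivity)]
    exact Real.log_le_log hp0 h2
  have h4 := abs_nonneg (Real.log b)
  have h5 := abs_nonneg (Real.log (C / c ^ m))
  have h6 := neg_abs_le (Real.log b)
  have h7 := le_abs_self (Real.log (C / c ^ m))
  have h8 : (0 : ℝ) ≤ m := by positivity
  rw [abs_le]
  constructor <;> nlinarith

/-- The integrals of the products `∏ l, P l ^ σ l` are bounded on compact sets of exponents. -/
theorem exists_integral_exp_logProd_le (hP : ∀ l, Tame (P l)) {K : Set (ι → ℝ)}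
    (hK : IsCompact K) (hint : ∀ σ ∈ K, Integrable fun x => Real.exp (logProd P σ x))
    (Q : MvPolynomial (Fin N) ℝ) (hQ1 : ∀ x, 1 ≤ eval x Q)
    (hQ : ∃ c, 0 < c ∧ ∀ x : Fin N → ℝ, c * (1 + ‖x‖) ≤ eval x Q) :
    ∃ M, ∀ σ ∈ K, ∫ x, Real.exp (logProd P σ x) ≤ M := by
  choose A hA0 hA using fun l => (hP l).abs_log_le hQ1 hQ
  have hpert (σ σ' : ι → ℝ) (x : Fin N → ℝ) : logProd P σ' x
      ≤ logProd P σ x + ‖σ' - σ‖ * (∑ l, A l) * (1 + Real.log (eval x Q)) := by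
    have h1 : logProd P σ' x - logProd P σ x = ∑ l, (σ' l - σ l) * Real.log (eval x (P l)) := by
      rw [logProd, logProd, ← Finset.sum_sub_distrib]
      exact Finset.sum_congr rfl fun l _ => by ring
    have h2 : ∑ l, (σ' l - σ l) * Real.log (eval x (P l))
        ≤ ∑ l, ‖σ' - σ‖ * (A l * (1 + Real.log (eval x Q))) := by
      refine Finset.sum_le_sum fun l _ => (le_abs_self _).trans ?_
      rw [abs_mul]
      exact mul_le_mul (norm_le_pi_norm (σ' - σ) l) (hA l x) (abs_nonneg _) (norm_nonneg _)
    rw [← Finset.mul_sum, ← Finset.sum_mul, ← mul_assoc, ← h1] at h2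
    linarith
  suffices h : ∃ M, ∀ σ ∈ K, σ ∈ K → ∫ x, Real.exp (logProd P σ x) ≤ M by
    obtain ⟨M, hM⟩ := h
    exact ⟨M, fun σ hσ => hM σ hσ hσ⟩
  -- near `σ` the change of the exponents costs at most a factor `exp δ * Q ^ δ`
  refine hK.induction_on (p := fun S => ∃ M, ∀ σ ∈ S, σ ∈ K →
    ∫ x, Real.exp (logProd P σ x) ≤ M) ⟨0, by simp⟩ ?_ ?_ ?_
  · rintro s t hst ⟨M, hM⟩
    exact ⟨M, fun σ hσ => hM σ (hst hσ)⟩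
  · rintro s t ⟨M, hM⟩ ⟨M', hM'⟩
    refine ⟨max M M', fun σ hσ hσK => ?_⟩
    rcases hσ with hσ | hσ
    · exact (hM σ hσ hσK).trans (le_max_left _ _)
    · exact (hM' σ hσ hσK).trans (le_max_right _ _)
  · intro σ hσ
    obtain ⟨δ, hδ, hδint⟩ := exists_integrable_exp_logProd_add hP σ (hint σ hσ) Q hQ1 hQ
    have hSA : 0 ≤ ∑ l, A l := Finset.sum_nonneg fun l _ => hA0 l
    refine ⟨_, mem_nhdsWithin_of_mem_nhds (Metric.ball_mem_nhds σ
      (show 0 < δ / (1 + ∑ l, A l) by positivity)),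
      ∫ x, Real.exp δ * Real.exp (logProd P σ x + δ * Real.log (eval x Q)), ?_⟩
    intro σ' hσ' hσ'K
    refine integral_mono (hint σ' hσ'K) (hδint.const_mul _) fun x => ?_
    simp only
    rw [← Real.exp_add, Real.exp_le_exp]
    have h1 : ‖σ' - σ‖ * ∑ l, A l ≤ δ := by
      rw [Metric.mem_ball, dist_eq_norm, lt_div_iff₀ (by positivity)] at hσ'
      nlinarith [norm_nonneg (σ' - σ)]
    have h2 := mul_le_mul_of_nonneg_right h1
      (show 0 ≤ 1 + Real.log (eval x Q) by linarith [Real.log_nonneg (hQ1 x)])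
    linarith [hpert σ σ' x]

/-! ### Decay of Fourier transforms -/

/-- The product `∏ l, P l x ^ lam l` for complex exponents. -/
noncomputable def cpowProd (P : ι → MvPolynomial (Fin N) ℝ) (lam : ι → ℂ) (x : Fin N → ℝ) : ℂ :=
  Complex.exp (∑ l, lam l * (Real.log (eval x (P l)) : ℂ))

theorem norm_cpowProd (lam : ι → ℂ) (x : Fin N → ℝ) :
    ‖cpowProd P lam x‖ = Real.exp (logProd P (fun l => (lam l).re) x) := by
  simp [cpowProd, logProd, Complex.norm_exp]

end RealPolynomial

namespace RealPolynomial

variable {N : ℕ} {ι : Type*} {P : ι → MvPolynomial (Fin N) ℝ}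

/-- The functions of `lam` and `x` that are built by sums and products from the coordinates of `lam`
and the ratios `∂_j ^ a (P l) / P l`. The natural number is a bound for the degree in `lam`. -/
inductive IsSymbol (P : ι → MvPolynomial (Fin N) ℝ) (j : Fin N) :
    ℕ → ((ι → ℂ) → (Fin N → ℝ) → ℂ) → Prop
  | const (c : ℂ) : IsSymbol P j 0 fun _ _ => c
  | coord (l : ι) : IsSymbol P j 1 fun lam _ => lam l
  | ratio (l : ι) (a : ℕ) : IsSymbol P j 0 fun _ x =>
      ((eval x ((pderiv j)^[a] (P l)) / eval x (P l) : ℝ) : ℂ)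
  | add {d : ℕ} {R S : (ι → ℂ) → (Fin N → ℝ) → ℂ} : IsSymbol P j d R → IsSymbol P j d S →
      IsSymbol P j d fun lam x => R lam x + S lam x
  | mul {d e : ℕ} {R S : (ι → ℂ) → (Fin N → ℝ) → ℂ} : IsSymbol P j d R → IsSymbol P j e S →
      IsSymbol P j (d + e) fun lam x => R lam x * S lam x
  | mono {d e : ℕ} {R : (ι → ℂ) → (Fin N → ℝ) → ℂ} : d ≤ e → IsSymbol P j d R → IsSymbol P j e R

namespace IsSymbol

variable {j : Fin N} {d : ℕ} {R : (ι → ℂ) → (Fin N → ℝ) → ℂ}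

theorem norm_le [Fintype ι] (hP : ∀ l, Tame (P l)) (hR : IsSymbol P j d R) :
    ∃ C, 0 ≤ C ∧ ∀ lam x, ‖R lam x‖ ≤ C * (1 + ‖lam‖) ^ d := by
  induction hR with
  | const c => exact ⟨‖c‖, norm_nonneg _, by simp⟩
  | coord l =>
    refine ⟨1, zero_le_one, fun lam x => ?_⟩
    have := norm_le_pi_norm lam l
    linarith
  | ratio l a =>
    obtain ⟨C, hC, h⟩ := (hP l).abs_iterate_pderiv_le j a
    refine ⟨C, hC, fun lam x => ?_⟩
    rw [pow_zero, mul_one, Complex.norm_real, Real.norm_eq_abs, abs_div,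
      abs_of_pos ((hP l).pos x), div_le_iff₀ ((hP l).pos x)]
    exact h x
  | add _ _ ihR ihS =>
    obtain ⟨C, hC, h⟩ := ihR
    obtain ⟨C', hC', h'⟩ := ihS
    refine ⟨C + C', by positivity, fun lam x => ?_⟩
    rw [add_mul]
    exact (norm_add_le _ _).trans (add_le_add (h lam x) (h' lam x))
  | mul _ _ ihR ihS =>
    obtain ⟨C, hC, h⟩ := ihR
    obtain ⟨C', hC', h'⟩ := ihS
    refine ⟨C * C', by positivity, fun lam x => ?_⟩
    rw [norm_mul, pow_add, mul_mul_mul_comm]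
    exact mul_le_mul (h lam x) (h' lam x) (norm_nonneg _) (by positivity)
  | mono hde _ ih =>
    obtain ⟨C, hC, h⟩ := ih
    refine ⟨C, hC, fun lam x => (h lam x).trans ?_⟩
    refine mul_le_mul_of_nonneg_left (pow_le_pow_right₀ ?_ hde) hC
    linarith [norm_nonneg lam]

theorem continuous (hP : ∀ l, Tame (P l)) (hR : IsSymbol P j d R) (lam : ι → ℂ) :
    Continuous (R lam) := by
  induction hR with
  | const c => exact continuous_const
  | coord l => exact continuous_const
  | ratio l a =>
    exact Complex.continuous_ofReal.comp ((MvPolynomial.continuous_eval _).div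
      (MvPolynomial.continuous_eval _) fun x => ((hP l).pos x).ne')
  | add _ _ ihR ihS => exact ihR.add ihS
  | mul _ _ ihR ihS => exact ihR.mul ihS
  | mono _ _ ih => exact ih

theorem exists_hasLineDerivAt (hP : ∀ l, Tame (P l)) (hR : IsSymbol P j d R) :
    ∃ R', IsSymbol P j d R' ∧
      ∀ lam x, HasLineDerivAt ℝ (R lam) (R' lam x) x (Pi.single j 1) := by
  induction hR with
  | const c =>
    exact ⟨_, const 0, fun lam x => hasDerivAt_const (0 : ℝ) c⟩
  | coord l =>
    exact ⟨_, mono zero_le_one (const 0), fun lam x => hasDerivAt_const (0 : ℝ) (lam l)⟩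
  | ratio l a =>
    refine ⟨_, add (ratio l (a + 1)) (mul (const (-1)) (mul (ratio l a) (ratio l 1))),
      fun lam x => ?_⟩
    have h1 := hasLineDerivAt_eval ((pderiv j)^[a] (P l)) j x
    have h2 := hasLineDerivAt_eval (P l) j x
    unfold HasLineDerivAt at h1 h2 ⊢
    refine (h1.fun_div h2 ((hP l).pos _).ne').ofReal_comp.congr_deriv ?_
    have h0 := ((hP l).pos x).ne'
    rw [zero_smul, add_zero, Function.iterate_succ_apply', Function.iterate_one, neg_one_mul,
      ← Complex.ofReal_mul, ← Complex.ofReal_neg, ← Complex.ofReal_add]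
    congr 1
    field_simp
    ring
  | add _ _ ihR ihS =>
    obtain ⟨R', hR', h⟩ := ihR
    obtain ⟨S', hS', h'⟩ := ihS
    exact ⟨_, add hR' hS', fun lam x => HasDerivAt.fun_add (h lam x) (h' lam x)⟩
  | mul hR hS ihR ihS =>
    obtain ⟨R', hR', h⟩ := ihR
    obtain ⟨S', hS', h'⟩ := ihS
    refine ⟨_, add (mul hR' hS) (mul hR hS'), fun lam x => ?_⟩
    have := HasDerivAt.fun_mul (h lam x) (h' lam x)
    simpa [HasLineDerivAt] using this
  | mono hde _ ih =>
    obtain ⟨R', hR', h⟩ := ih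
    exact ⟨R', mono hde hR', h⟩

theorem sum {s : Finset ι} {R : ι → (ι → ℂ) → (Fin N → ℝ) → ℂ}
    (h : ∀ l, IsSymbol P j d (R l)) : IsSymbol P j d fun lam x => ∑ l ∈ s, R l lam x := by
  classical
  induction s using Finset.induction_on with
  | empty => simpa using mono (Nat.zero_le d) (const 0)
  | insert l s hl ih =>
    simp only [Finset.sum_insert hl]
    exact add (h l) ih

theorem exists_hasLineDerivAt_cpowProd_mul [Fintype ι] (hP : ∀ l, Tame (P l))
    (hR : IsSymbol P j d R) :
    ∃ R', IsSymbol P j (d + 1) R' ∧ ∀ lam x,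
      HasLineDerivAt ℝ (fun x => cpowProd P lam x * R lam x) (cpowProd P lam x * R' lam x) x
        (Pi.single j 1) := by
  obtain ⟨R', hR', h⟩ := hR.exists_hasLineDerivAt hP
  refine ⟨_, add (mono (Nat.le_succ d) hR')
    (mul hR (sum (s := Finset.univ) fun l => mul (coord l) (ratio l 1))), fun lam x => ?_⟩
  have h1 : HasDerivAt (fun t : ℝ => cpowProd P lam (x + t • Pi.single j 1))
      (cpowProd P lam x * ∑ l, lam l * ((eval x ((pderiv j)^[1] (P l)) / eval x (P l) : ℝ) : ℂ))
      0 := by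
    have h2 : HasDerivAt
        (fun t : ℝ => ∑ l, lam l * (Real.log (eval (x + t • Pi.single j 1) (P l)) : ℂ))
        (∑ l, lam l * ((eval x ((pderiv j)^[1] (P l)) / eval x (P l) : ℝ) : ℂ)) 0 :=
      HasDerivAt.fun_sum fun l _ =>
        (HasDerivAt.ofReal_comp (hasLineDerivAt_log_eval (hP l).pos j x)).const_mul (lam l)
    refine h2.cexp.congr_deriv ?_
    rw [zero_smul, add_zero, cpowProd]
  refine (HasDerivAt.fun_mul h1 (h lam x)).congr_deriv ?_
  rw [zero_smul, add_zero]
  ring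

end IsSymbol

variable [Fintype ι]

theorem continuous_cpowProd (hP : ∀ l, Tame (P l)) (lam : ι → ℂ) : Continuous (cpowProd P lam) :=
  Complex.continuous_exp.comp <| continuous_finsetSum _ fun l _ =>
    (Complex.continuous_ofReal.comp (continuous_log_eval (hP l).pos)).const_mul (lam l)

/-- The additive character `x ↦ exp (-2πi ∑ b_i x_i)` of `ℝ ^ N`. -/
noncomputable def character (b x : Fin N → ℝ) : ℂ :=
  Complex.exp (-(2 * (Real.pi : ℂ) * Complex.I * ((∑ i, b i * x i : ℝ) : ℂ)))

theorem norm_character (b x : Fin N → ℝ) : ‖character b x‖ = 1 := by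
  rw [character, show -(2 * (Real.pi : ℂ) * Complex.I * ((∑ i, b i * x i : ℝ) : ℂ))
    = ((-(2 * Real.pi * ∑ i, b i * x i) : ℝ) : ℂ) * Complex.I by push_cast; ring]
  exact Complex.norm_exp_ofReal_mul_I _

theorem continuous_character (b : Fin N → ℝ) : Continuous (character b) := by
  unfold character
  fun_prop

theorem hasLineDerivAt_character (b : Fin N → ℝ) (j : Fin N) (x : Fin N → ℝ) :
    HasLineDerivAt ℝ (character b) (-(2 * (Real.pi : ℂ) * Complex.I * (b j : ℂ)) * character b x) x
      (Pi.single j 1) := by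
  have h1 : HasDerivAt (fun t : ℝ => ∑ i, b i * (x + t • (Pi.single j (1 : ℝ) : Fin N → ℝ)) i)
      (b j) 0 := by
    have h2 (t : ℝ) : ∑ i, b i * (x + t • (Pi.single j (1 : ℝ) : Fin N → ℝ)) i
        = (∑ i, b i * x i) + t * b j := by
      simp only [Pi.add_apply, Pi.smul_apply, smul_eq_mul, mul_add, Finset.sum_add_distrib]
      congr 1
      rw [Finset.sum_eq_single j (fun i _ hi => by simp [hi]) (by simp)]
      simp [mul_comm]
    simp only [h2]
    simpa using ((hasDerivAt_id (0 : ℝ)).mul_const (b j)).const_add (∑ i, b i * x i)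
  have h3 := ((h1.ofReal_comp).const_mul (2 * (Real.pi : ℂ) * Complex.I)).neg.cexp
  unfold HasLineDerivAt
  refine h3.congr_deriv ?_
  simp only [zero_smul, add_zero, Pi.neg_apply]
  rw [mul_comm]
  rfl

theorem integrable_cpowProd_mul_mul (hP : ∀ l, Tame (P l)) {j : Fin N} {d : ℕ}
    {R : (ι → ℂ) → (Fin N → ℝ) → ℂ} (hR : IsSymbol P j d R) (lam : ι → ℂ)
    (hint : Integrable fun x => Real.exp (logProd P (fun l => (lam l).re) x)) (b : Fin N → ℝ) :
    Integrable fun x => cpowProd P lam x * R lam x * character b x := by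
  obtain ⟨C, hC, h⟩ := hR.norm_le hP
  refine Integrable.mono' (hint.mul_const (C * (1 + ‖lam‖) ^ d))
    (((continuous_cpowProd hP lam).mul (hR.continuous hP lam)).mul
      (continuous_character b)).aestronglyMeasurable (ae_of_all _ fun x => ?_)
  rw [norm_mul, norm_mul, norm_character, mul_one, norm_cpowProd]
  exact mul_le_mul_of_nonneg_left (h lam x) (Real.exp_pos _).le

/-- Integration by parts `d` times in the direction of the `j`-th coordinate. -/
theorem exists_pow_mul_integral_eq (hP : ∀ l, Tame (P l)) (j : Fin N) (d : ℕ) :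
    ∃ R, IsSymbol P j d R ∧ ∀ (lam : ι → ℂ) (b : Fin N → ℝ),
      Integrable (fun x => Real.exp (logProd P (fun l => (lam l).re) x)) →
      (2 * (Real.pi : ℂ) * Complex.I * (b j : ℂ)) ^ d * ∫ x, cpowProd P lam x * character b x
        = ∫ x, cpowProd P lam x * R lam x * character b x := by
  induction d with
  | zero => exact ⟨_, .const 1, fun lam b _ => by simp⟩
  | succ d ih =>
    obtain ⟨R, hR, h⟩ := ih
    obtain ⟨R', hR', h'⟩ := hR.exists_hasLineDerivAt_cpowProd_mul hP
    refine ⟨R', hR', fun lam b hint => ?_⟩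
    have h1 := integrable_cpowProd_mul_mul hP hR lam hint b
    have h2 := integrable_cpowProd_mul_mul hP hR' lam hint b
    have hibp := integral_bilinear_hasLineDerivAt_right_eq_neg_left_of_integrable
      (μ := (volume : Measure (Fin N → ℝ))) (B := ContinuousLinearMap.mul ℝ ℂ)
      (f := fun x => cpowProd P lam x * R lam x) (f' := fun x => cpowProd P lam x * R' lam x)
      (g := character b)
      (g' := fun x => -(2 * (Real.pi : ℂ) * Complex.I * (b j : ℂ)) * character b x)
      (v := Pi.single j 1) (by simpa using h2)
      ((h1.const_mul (-(2 * (Real.pi : ℂ) * Complex.I * (b j : ℂ)))).congr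
        (ae_of_all _ fun x => by simp only [ContinuousLinearMap.mul_apply']; ring))
      (by simpa using h1) (fun x _ => h' lam x) (fun x _ => hasLineDerivAt_character b j x)
    simp only [ContinuousLinearMap.mul_apply'] at hibp
    rw [pow_succ', mul_assoc, h lam b hint, ← neg_inj, ← hibp, ← integral_const_mul,
      ← integral_neg]
    congr 1 with x
    ring

/-- The Fourier transform of a product of complex powers of tame polynomials decreases rapidly, with
polynomial dependence on the exponents. -/
theorem exists_pow_mul_norm_fourier_le (hP : ∀ l, Tame (P l)) (d : ℕ) :
    ∃ C, 0 ≤ C ∧ ∀ (lam : ι → ℂ) (b : Fin N → ℝ),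
      Integrable (fun x => Real.exp (logProd P (fun l => (lam l).re) x)) →
      (1 + ‖b‖) ^ d * ‖∫ x, cpowProd P lam x * character b x‖
        ≤ C * (1 + ‖lam‖) ^ d * ∫ x, Real.exp (logProd P (fun l => (lam l).re) x) := by
  choose R hR h using fun j => exists_pow_mul_integral_eq hP j d
  choose C hC hCR using fun j => (hR j).norm_le hP
  have hS : 0 ≤ ∑ j, C j := Finset.sum_nonneg fun j _ => hC j
  refine ⟨2 ^ d * (1 + ∑ j, C j), by positivity, fun lam b hint => ?_⟩
  set I := ∫ x, Real.exp (logProd P (fun l => (lam l).re) x) with hI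
  have hI0 : 0 ≤ I := integral_nonneg fun x => (Real.exp_pos _).le
  have hlam : 1 ≤ (1 + ‖lam‖) ^ d := one_le_pow₀ (by linarith [norm_nonneg lam])
  have htriv : ‖∫ x, cpowProd P lam x * character b x‖ ≤ I := by
    refine norm_integral_le_of_norm_le hint (ae_of_all _ fun x => ?_)
    rw [norm_mul, norm_character, mul_one, norm_cpowProd]
  rcases le_total ‖b‖ 1 with hb | hb
  · calc (1 + ‖b‖) ^ d * ‖∫ x, cpowProd P lam x * character b x‖ ≤ 2 ^ d * I := by
          refine mul_le_mul (pow_le_pow_left₀ (by positivity) (by linarith) _) htriv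
            (norm_nonneg _) (by positivity)
      _ ≤ 2 ^ d * (1 + ∑ j, C j) * (1 + ‖lam‖) ^ d * I := by
          refine mul_le_mul_of_nonneg_right ?_ hI0
          rw [mul_assoc]
          exact le_mul_of_one_le_right (by positivity)
            (one_le_mul_of_one_le_of_one_le (by linarith) hlam)
  · have hne : Nonempty (Fin N) := by
      by_contra h0
      rw [not_nonempty_iff] at h0
      have : b = 0 := Subsingleton.elim _ _
      rw [this, norm_zero] at hb
      linarith
    obtain ⟨j, -, hj⟩ := Finset.exists_mem_eq_sup' (s := Finset.univ) Finset.univ_nonempty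
      fun i => ‖b i‖₊
    have hj' : ‖b‖ = ‖b j‖ := by
      rw [Pi.norm_def, ← Finset.sup'_eq_sup Finset.univ_nonempty, hj, coe_nnnorm]
    have h1 : ‖b‖ ^ d * ‖∫ x, cpowProd P lam x * character b x‖
        ≤ C j * (1 + ‖lam‖) ^ d * I := by
      calc ‖b‖ ^ d * ‖∫ x, cpowProd P lam x * character b x‖
          ≤ ‖2 * (Real.pi : ℂ) * Complex.I * (b j : ℂ)‖ ^ d
            * ‖∫ x, cpowProd P lam x * character b x‖ := by
            refine mul_le_mul_of_nonneg_right (pow_le_pow_left₀ (norm_nonneg _) ?_ _)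
              (norm_nonneg _)
            rw [hj', norm_mul, norm_mul, norm_mul, Complex.norm_I, Complex.norm_real,
              Complex.norm_real, Real.norm_of_nonneg Real.pi_pos.le, Complex.norm_ofNat, mul_one]
            exact le_mul_of_one_le_left (norm_nonneg _) (by linarith [Real.pi_gt_three])
        _ = ‖∫ x, cpowProd P lam x * R j lam x * character b x‖ := by
            rw [← norm_pow, ← norm_mul, h j lam b hint]
        _ ≤ ∫ x, C j * (1 + ‖lam‖) ^ d * Real.exp (logProd P (fun l => (lam l).re) x) := by
            refine norm_integral_le_of_norm_le (hint.const_mul _) (ae_of_all _ fun x => ?_)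
            rw [norm_mul, norm_mul, norm_character, mul_one, norm_cpowProd, mul_comm]
            exact mul_le_mul_of_nonneg_right (hCR j lam x) (Real.exp_pos _).le
        _ = _ := integral_const_mul _ _
    have hCj : C j ≤ 1 + ∑ j, C j := by
      have := Finset.single_le_sum (fun j _ => hC j) (Finset.mem_univ j)
      linarith
    calc (1 + ‖b‖) ^ d * ‖∫ x, cpowProd P lam x * character b x‖
        ≤ 2 ^ d * (‖b‖ ^ d * ‖∫ x, cpowProd P lam x * character b x‖) := by
          rw [← mul_assoc, ← mul_pow]
          exact mul_le_mul_of_nonneg_right (pow_le_pow_left₀ (by positivity) (by linarith) _)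
            (norm_nonneg _)
      _ ≤ 2 ^ d * ((1 + ∑ j, C j) * (1 + ‖lam‖) ^ d * I) := by
          refine mul_le_mul_of_nonneg_left (h1.trans ?_) (by positivity)
          gcongr
      _ = _ := by ring

end RealPolynomial

/-! ### The norms of the canonical sections in real coordinates -/

namespace RealPolynomial

variable {N n : ℕ}

/-- The real functions on `ℝ ^ N` given by polynomials of degree at most `d`. -/
def IsPolyFun (d : ℕ) (f : (Fin N → ℝ) → ℝ) : Prop :=
  ∃ p : MvPolynomial (Fin N) ℝ, p.totalDegree ≤ d ∧ ∀ y, eval y p = f y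

namespace IsPolyFun

variable {d e : ℕ} {f g : (Fin N → ℝ) → ℝ}

theorem const (c : ℝ) : IsPolyFun d fun _ : Fin N → ℝ => c :=
  ⟨C c, by simp, by simp⟩

theorem mono (hde : d ≤ e) (hf : IsPolyFun d f) : IsPolyFun e f := by
  obtain ⟨p, hp, h⟩ := hf
  exact ⟨p, hp.trans hde, h⟩

theorem add (hf : IsPolyFun d f) (hg : IsPolyFun d g) : IsPolyFun d fun y => f y + g y := by
  obtain ⟨p, hp, h⟩ := hf
  obtain ⟨q, hq, h'⟩ := hg
  exact ⟨p + q, (totalDegree_add _ _).trans (max_le hp hq), fun y => by rw [map_add, h, h']⟩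

theorem mul (hf : IsPolyFun d f) (hg : IsPolyFun e g) : IsPolyFun (d + e) fun y => f y * g y := by
  obtain ⟨p, hp, h⟩ := hf
  obtain ⟨q, hq, h'⟩ := hg
  exact ⟨p * q, (totalDegree_mul _ _).trans (add_le_add hp hq), fun y => by rw [map_mul, h, h']⟩

theorem sub (hf : IsPolyFun d f) (hg : IsPolyFun d g) : IsPolyFun d fun y => f y - g y := by
  obtain ⟨p, hp, h⟩ := hf
  obtain ⟨q, hq, h'⟩ := hg
  exact ⟨p - q, (totalDegree_sub _ _).trans (max_le hp hq), fun y => by rw [map_sub, h, h']⟩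

theorem pow (hf : IsPolyFun d f) (k : ℕ) : IsPolyFun (k * d) fun y => f y ^ k := by
  obtain ⟨p, hp, h⟩ := hf
  exact ⟨p ^ k, (totalDegree_pow _ _).trans (Nat.mul_le_mul_left _ hp), fun y => by
    rw [map_pow, h]⟩

theorem sum {κ : Type*} {s : Finset κ} {f : κ → (Fin N → ℝ) → ℝ}
    (hf : ∀ k ∈ s, IsPolyFun d (f k)) : IsPolyFun d fun y => ∑ k ∈ s, f k y := by
  classical
  induction s using Finset.induction_on with
  | empty => simpa using const 0
  | insert k s hk ih =>
    simp only [Finset.sum_insert hk]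
    exact add (hf k (Finset.mem_insert_self k s))
      (ih fun i hi => hf i (Finset.mem_insert_of_mem hi))

theorem linear (u : (Fin N → ℝ) →ₗ[ℝ] ℝ) : IsPolyFun 1 u := by
  have h : ∀ y, ∑ j, y j * u (Pi.single j 1) = u y := fun y => by
    conv_rhs => rw [pi_eq_sum_univ' y]
    simp [map_sum]
  refine ⟨∑ j, X j * C (u (Pi.single j 1)), ?_, fun y => by simp [h]⟩
  refine totalDegree_finsetSum_le fun j _ => ?_
  exact (totalDegree_mul _ _).trans (by simp)

end IsPolyFun

variable {𝕜 : Type*} [RCLike 𝕜]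

/-- The functions with values in `ℝ` or `ℂ` whose real and imaginary parts are given by polynomials
of degree at most `d`. -/
def IsRCPolyFun (d : ℕ) (f : (Fin N → ℝ) → 𝕜) : Prop :=
  IsPolyFun d (fun y => RCLike.re (f y)) ∧ IsPolyFun d (fun y => RCLike.im (f y))

namespace IsRCPolyFun

variable {d e : ℕ} {f g : (Fin N → ℝ) → 𝕜}

theorem const (c : 𝕜) : IsRCPolyFun d fun _ : Fin N → ℝ => c :=
  ⟨.const _, .const _⟩

theorem mono (hde : d ≤ e) (hf : IsRCPolyFun d f) : IsRCPolyFun e f :=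
  ⟨hf.1.mono hde, hf.2.mono hde⟩

theorem mul (hf : IsRCPolyFun d f) (hg : IsRCPolyFun e g) :
    IsRCPolyFun (d + e) fun y => f y * g y := by
  simp only [IsRCPolyFun, RCLike.mul_re, RCLike.mul_im]
  exact ⟨(hf.1.mul hg.1).sub (hf.2.mul hg.2), (hf.1.mul hg.2).add (hf.2.mul hg.1)⟩

theorem sum {κ : Type*} {s : Finset κ} {f : κ → (Fin N → ℝ) → 𝕜}
    (hf : ∀ k ∈ s, IsRCPolyFun d (f k)) : IsRCPolyFun d fun y => ∑ k ∈ s, f k y := by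
  simp only [IsRCPolyFun, map_sum]
  exact ⟨.sum fun k hk => (hf k hk).1, .sum fun k hk => (hf k hk).2⟩

theorem pow (hf : IsRCPolyFun d f) (k : ℕ) : IsRCPolyFun (k * d) fun y => f y ^ k := by
  induction k with
  | zero => simpa using const 1
  | succ k ih =>
    simp only [pow_succ, Nat.succ_mul]
    exact ih.mul hf

theorem prod {κ : Type*} {s : Finset κ} {d : κ → ℕ} {f : κ → (Fin N → ℝ) → 𝕜}
    (hf : ∀ k ∈ s, IsRCPolyFun (d k) (f k)) :
    IsRCPolyFun (∑ k ∈ s, d k) fun y => ∏ k ∈ s, f k y := by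
  classical
  induction s using Finset.induction_on with
  | empty => simpa using const 1
  | insert k s hk ih =>
    simp only [Finset.prod_insert hk, Finset.sum_insert hk]
    exact mul (hf k (Finset.mem_insert_self k s))
      (ih fun i hi => hf i (Finset.mem_insert_of_mem hi))

theorem norm_sq (hf : IsRCPolyFun d f) : IsPolyFun (2 * d) fun y => ‖f y‖ ^ 2 := by
  have h (y) : ‖f y‖ ^ 2 = RCLike.re (f y) * RCLike.re (f y) + RCLike.im (f y) * RCLike.im (f y) :=
    RCLike.norm_sq_eq_def
  simp only [h, two_mul]
  exact (hf.1.mul hf.1).add (hf.2.mul hf.2)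

theorem eval {κ : Type*} [Fintype κ] {z : (Fin N → ℝ) → κ → 𝕜}
    (hz : ∀ i, IsRCPolyFun 1 fun y => z y i) (G : MvPolynomial κ 𝕜) {d : ℕ}
    (hd : G.totalDegree ≤ d) : IsRCPolyFun d fun y => MvPolynomial.eval (z y) G := by
  simp only [eval_eq']
  refine sum fun m hm => ?_
  have h1 := (const (N := N) (d := 0) (coeff m G)).mul
    (prod (s := Finset.univ) fun i _ => (hz i).pow (m i))
  refine h1.mono ?_
  have h2 := le_totalDegree hm
  rw [Finsupp.sum_fintype _ _ (by simp)] at h2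
  simp only [mul_one, zero_add]
  exact h2.trans hd

end IsRCPolyFun

/-- The affine chart `x ↦ (1, x)` in real coordinates. -/
noncomputable def chart (e : (Fin N → ℝ) ≃L[ℝ] (Fin n → 𝕜)) (y : Fin N → ℝ) : Fin (n + 1) → 𝕜 :=
  Fin.cons 1 (e y)

variable (e : (Fin N → ℝ) ≃L[ℝ] (Fin n → 𝕜))

theorem isRCPolyFun_chart (i : Fin (n + 1)) : IsRCPolyFun 1 fun y => chart e y i := by
  refine Fin.cases ?_ (fun i => ?_) i
  · simpa [chart] using IsRCPolyFun.const 1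
  · simp only [chart, Fin.cons_succ]
    exact ⟨.linear (RCLike.reLm ∘ₗ (LinearMap.proj i : (Fin n → 𝕜) →ₗ[ℝ] 𝕜) ∘ₗ e.toLinearMap),
      .linear (RCLike.imLm ∘ₗ (LinearMap.proj i : (Fin n → 𝕜) →ₗ[ℝ] 𝕜) ∘ₗ e.toLinearMap)⟩

theorem sum_norm_sq_chart (y : Fin N → ℝ) :
    ∑ i, ‖chart e y i‖ ^ 2 = 1 + ∑ i, ‖e y i‖ ^ 2 := by
  simp [Fin.sum_univ_succ, chart]

theorem one_le_sum_norm_sq_chart (y : Fin N → ℝ) : 1 ≤ ∑ i, ‖chart e y i‖ ^ 2 := by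
  rw [sum_norm_sq_chart]
  exact le_add_of_nonneg_right (by positivity)

theorem exists_le_sum_norm_sq_chart :
    ∃ c, 0 < c ∧ ∀ y, c * (1 + ‖y‖) ^ 2 ≤ ∑ i, ‖chart e y i‖ ^ 2 := by
  set K := ‖(e.symm : (Fin n → 𝕜) →L[ℝ] (Fin N → ℝ))‖ with hK
  refine ⟨1 / (2 * (1 + K ^ 2)), by positivity, fun y => ?_⟩
  have h1 : ‖y‖ ≤ K * ‖e y‖ := by
    simpa using (e.symm : (Fin n → 𝕜) →L[ℝ] (Fin N → ℝ)).le_opNorm (e y)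
  have h2 : ‖e y‖ ^ 2 ≤ ∑ i, ‖e y i‖ ^ 2 := by
    have h3 : ‖e y‖ ≤ Real.sqrt (∑ i, ‖e y i‖ ^ 2) := by
      refine (pi_norm_le_iff_of_nonneg (Real.sqrt_nonneg _)).2 fun i => ?_
      refine Real.le_sqrt_of_sq_le ?_
      exact Finset.single_le_sum (f := fun i => ‖e y i‖ ^ 2) (fun _ _ => by positivity)
        (Finset.mem_univ i)
    calc ‖e y‖ ^ 2 ≤ Real.sqrt (∑ i, ‖e y i‖ ^ 2) ^ 2 := pow_le_pow_left₀ (norm_nonneg _) h3 _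
      _ = _ := Real.sq_sqrt (by positivity)
  rw [sum_norm_sq_chart, div_mul_eq_mul_div, div_le_iff₀ (by positivity)]
  have h4 : ‖y‖ ^ 2 ≤ K ^ 2 * ‖e y‖ ^ 2 := by
    rw [← mul_pow]
    exact pow_le_pow_left₀ (norm_nonneg _) h1 _
  have h5 : (1 + ‖y‖) ^ 2 ≤ 2 * (1 + ‖y‖ ^ 2) := by nlinarith [sq_nonneg (1 - ‖y‖)]
  nlinarith [sq_nonneg K, mul_le_mul_of_nonneg_left h2 (sq_nonneg K), sq_nonneg ‖e y‖]

theorem eval_smul_of_isHomogeneous {κ R : Type*} [Fintype κ] [CommSemiring R]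
    {G : MvPolynomial κ R} {d : ℕ}
    (hG : G.IsHomogeneous d) (c : R) (z : κ → R) : eval (c • z) G = c ^ d * eval z G := by
  rw [eval_eq', eval_eq', Finset.mul_sum]
  refine Finset.sum_congr rfl fun m hm => ?_
  have h : ∑ i, m i = d := by
    have := hG (mem_support_iff.1 hm)
    rw [Finsupp.weight_apply, Finsupp.sum_fintype _ _ (by simp)] at this
    simpa using this
  simp only [Pi.smul_apply, smul_eq_mul, mul_pow, Finset.prod_mul_distrib,
    Finset.prod_pow_eq_pow_sum, h]
  ring

/-- Since `x₀` lies in the ideal of the centre, the square of the norm of the canonical section is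
bounded below by a multiple of the square of the norm of `x₀`. -/
theorem exists_le_sum_norm_sq_div {κ : Type*} [Fintype κ] (G : κ → MvPolynomial (Fin (n + 1)) 𝕜)
    (d : κ → ℕ) (hG : ∀ j, (G j).IsHomogeneous (d j)) (hX : X 0 ∈ Ideal.span (Set.range G)) :
    ∃ c, 0 < c ∧ ∀ z : Fin (n + 1) → 𝕜, z 0 = 1 → c / (∑ i, ‖z i‖ ^ 2)
      ≤ ∑ j, ‖eval z (G j)‖ ^ 2 / (∑ i, ‖z i‖ ^ 2) ^ d j := by
  obtain ⟨h, hh⟩ := Ideal.mem_span_range_iff_exists_fun.1 hX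
  have hbd (j : κ) : ∃ B, 0 ≤ B ∧ ∀ z ∈ Metric.closedBall (0 : Fin (n + 1) → 𝕜) 1,
      ‖eval z (h j)‖ ≤ B := by
    obtain ⟨B, hB⟩ := (isCompact_closedBall (0 : Fin (n + 1) → 𝕜) 1).exists_bound_of_continuousOn
      (MvPolynomial.continuous_eval (h j)).continuousOn
    exact ⟨max B 0, le_max_right _ _, fun z hz => (hB z hz).trans (le_max_left _ _)⟩
  choose B hB0 hB using hbd
  have hS : 0 ≤ ∑ j, B j ^ 2 := Finset.sum_nonneg fun j _ => sq_nonneg _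
  refine ⟨1 / (1 + ∑ j, B j ^ 2), by positivity, fun z hz => ?_⟩
  set q := ∑ i, ‖z i‖ ^ 2 with hq
  have hq1 : 1 ≤ q := by
    have := Finset.single_le_sum (f := fun i => ‖z i‖ ^ 2) (fun _ _ => by positivity)
      (Finset.mem_univ 0)
    simpa [hz] using this
  -- normalize the vector `z` to have length one
  set c : 𝕜 := (((Real.sqrt q)⁻¹ : ℝ) : 𝕜) with hc
  have hcn : ‖c‖ ^ 2 = q⁻¹ := by
    rw [hc, RCLike.norm_ofReal, sq_abs, inv_pow, Real.sq_sqrt (by positivity)]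
  have hmem : c • z ∈ Metric.closedBall (0 : Fin (n + 1) → 𝕜) 1 := by
    rw [mem_closedBall_zero_iff, pi_norm_le_iff_of_nonneg zero_le_one]
    intro i
    rw [← abs_of_nonneg (norm_nonneg ((c • z) i)), ← sq_le_one_iff_abs_le_one, Pi.smul_apply,
      smul_eq_mul, norm_mul, mul_pow, hcn, inv_mul_le_iff₀ (by positivity), mul_one]
    exact Finset.single_le_sum (f := fun i => ‖z i‖ ^ 2) (fun _ _ => by positivity)
      (Finset.mem_univ i)
  have h1 : ‖c‖ ≤ ∑ j, B j * ‖eval (c • z) (G j)‖ := by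
    have h2 := congrArg (eval (c • z)) hh
    rw [map_sum, eval_X, Pi.smul_apply, hz, smul_eq_mul, mul_one] at h2
    refine (congrArg norm h2).symm.le.trans ((norm_sum_le _ _).trans ?_)
    refine Finset.sum_le_sum fun j _ => ?_
    rw [map_mul, norm_mul]
    exact mul_le_mul_of_nonneg_right (hB j _ hmem) (norm_nonneg _)
  have h2 : (∑ j, B j * ‖eval (c • z) (G j)‖) ^ 2
      ≤ (∑ j, B j ^ 2) * ∑ j, ‖eval (c • z) (G j)‖ ^ 2 :=
    Finset.sum_mul_sq_le_sq_mul_sq _ _ _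
  have h3 (j) : ‖eval (c • z) (G j)‖ ^ 2 = ‖eval z (G j)‖ ^ 2 / q ^ d j := by
    rw [eval_smul_of_isHomogeneous (hG j), norm_mul, norm_pow, mul_pow, ← pow_mul, mul_comm (d j),
      pow_mul, hcn, inv_pow, inv_mul_eq_div]
  simp only [h3] at h2
  set S := ∑ j, ‖eval z (G j)‖ ^ 2 / q ^ d j with hSdef
  have hS0 : 0 ≤ S := Finset.sum_nonneg fun j _ => by positivity
  have h4 : q⁻¹ ≤ (∑ j, B j ^ 2) * S := by
    rw [← hcn]
    exact (pow_le_pow_left₀ (norm_nonneg _) h1 2).trans h2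
  rw [one_div, div_eq_mul_inv, inv_mul_le_iff₀ (by positivity)]
  linarith

theorem exists_tame_sum_norm_sq_chart : ∃ Q : MvPolynomial (Fin N) ℝ,
    Tame Q ∧ ∀ y, eval y Q = ∑ i, ‖chart e y i‖ ^ 2 := by
  obtain ⟨Q, hQ, h⟩ := IsPolyFun.sum (s := Finset.univ)
    fun i _ => (isRCPolyFun_chart e i).norm_sq
  refine ⟨Q, ⟨0, 1, one_pos, hQ, fun y => ?_⟩, h⟩
  rw [h, pow_zero, mul_one]
  exact one_le_sum_norm_sq_chart e y

/-- The square of the norm of the canonical section of an exceptional divisor is the quotient of a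
tame polynomial by a power of `1 + ∑ ‖x_i‖ ^ 2`. -/
theorem exists_tame_sum_norm_sq_div {κ : Type*} [Fintype κ]
    (G : κ → MvPolynomial (Fin (n + 1)) 𝕜) (d : κ → ℕ) (hG : ∀ j, (G j).IsHomogeneous (d j))
    (hX : X 0 ∈ Ideal.span (Set.range G)) : ∃ (P : MvPolynomial (Fin N) ℝ) (D : ℕ), Tame P ∧
      ∀ y, ∑ j, ‖eval (chart e y) (G j)‖ ^ 2 / (∑ i, ‖chart e y i‖ ^ 2) ^ d j
        = eval y P / (∑ i, ‖chart e y i‖ ^ 2) ^ D := by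
  set D := 1 + ∑ j, d j with hD
  have hdD (j) : d j ≤ D := by
    have := Finset.single_le_sum (f := d) (fun _ _ => Nat.zero_le _) (Finset.mem_univ j)
    omega
  have hq : IsPolyFun 2 fun y => ∑ i, ‖chart e y i‖ ^ 2 :=
    IsPolyFun.sum (s := Finset.univ) fun i _ => (isRCPolyFun_chart e i).norm_sq
  obtain ⟨P, hP, h⟩ : IsPolyFun (2 * D) fun y =>
      ∑ j, ‖eval (chart e y) (G j)‖ ^ 2 * (∑ i, ‖chart e y i‖ ^ 2) ^ (D - d j) := by
    refine IsPolyFun.sum fun j _ => ?_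
    refine ((IsRCPolyFun.eval (isRCPolyFun_chart e) (G j)
      (hG j).totalDegree_le).norm_sq.mul (hq.pow (D - d j))).mono ?_
    have := hdD j
    omega
  have hEq (y) : ∑ j, ‖eval (chart e y) (G j)‖ ^ 2 / (∑ i, ‖chart e y i‖ ^ 2) ^ d j
      = eval y P / (∑ i, ‖chart e y i‖ ^ 2) ^ D := by
    have h0 : 0 < ∑ i, ‖chart e y i‖ ^ 2 := zero_lt_one.trans_le (one_le_sum_norm_sq_chart e y)
    rw [h, Finset.sum_div]
    refine Finset.sum_congr rfl fun j _ => ?_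
    rw [div_eq_div_iff (by positivity) (by positivity), mul_assoc, ← pow_add,
      Nat.sub_add_cancel (hdD j)]
  refine ⟨P, D, ?_, hEq⟩
  obtain ⟨c, hc, hcS⟩ := exists_le_sum_norm_sq_div G d hG hX
  obtain ⟨c', hc', hcQ⟩ := exists_le_sum_norm_sq_chart e
  refine ⟨2 * ∑ j, d j, c * c' ^ ∑ j, d j, by positivity, by omega, fun y => ?_⟩
  have h0 : 0 < ∑ i, ‖chart e y i‖ ^ 2 := zero_lt_one.trans_le (one_le_sum_norm_sq_chart e y)
  have h1 := hcS (chart e y) (by simp [chart])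
  rw [hEq, div_le_div_iff₀ h0 (by positivity), hD, pow_add, pow_one, ← mul_assoc,
    mul_right_comm] at h1
  have h2 := le_of_mul_le_mul_right h1 h0
  refine le_trans ?_ h2
  rw [mul_assoc, pow_mul, ← mul_pow]
  exact mul_le_mul_of_nonneg_left (pow_le_pow_left₀ (by positivity) (hcQ y) _) hc.le

end RealPolynomial

/-! ### Transport to real coordinates -/

namespace ArchimedeanPlace

open RealPolynomial

variable {F : Type*} [Field F] {v : InfinitePlace F} {𝕜 : Type*} [RCLike 𝕜]
  (φ : v.Completion ≃+* 𝕜) (hφ : ∀ x, ‖φ x‖ = ‖x‖) {N n r : ℕ}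
  (e : (Fin N → ℝ) ≃L[ℝ] (Fin n → 𝕜))

/-- Real coordinates on `F_v ^ n`, through an identification of `F_v` with `ℝ` or `ℂ`. -/
noncomputable def realCoord (y : Fin N → ℝ) : Fin n → v.Completion :=
  fun i => φ.symm (e y i)

theorem apply_cons_realCoord (y : Fin N → ℝ) (i : Fin (n + 1)) :
    φ ((Fin.cons 1 (realCoord φ e y) : Fin (n + 1) → v.Completion) i) = chart e y i := by
  refine Fin.cases ?_ (fun i => ?_) i <;> simp [realCoord, chart]

theorem localHeight_inv_eq_cpowProd {B : BlowupCentres F n r}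
    {P : Fin (r + 1) → MvPolynomial (Fin N) ℝ} {M : Fin (r + 1) → Fin (r + 1) → ℝ}
    {x : Fin n → v.Completion} {y : Fin N → ℝ}
    (h : ∀ k, 0 < B.sectionNorm v (Fin.cons 1 x) k ∧ Real.log (B.sectionNorm v (Fin.cons 1 x) k)
      = ∑ l, M k l * Real.log (eval y (P l))) (s : Fin (r + 1) → ℂ) :
    (B.localHeight v s x)⁻¹
      = cpowProd P (fun l => ∑ k, ((v.mult * M k l : ℝ) : ℂ) * s k) y := by
  rw [BlowupCentres.localHeight, ← Finset.prod_inv_distrib, cpowProd]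
  have h1 (k : Fin (r + 1)) :
      ((B.sectionNorm v (Fin.cons 1 x : Fin (n + 1) → v.Completion) k : ℂ) ^
        (-((v.mult : ℂ) * s k)))⁻¹
      = Complex.exp (∑ l, (v.mult : ℂ) * s k * (M k l * (Real.log (eval y (P l)) : ℂ))) := by
    rw [Complex.cpow_neg, inv_inv, Complex.cpow_def_of_ne_zero
      (Complex.ofReal_ne_zero.2 (h k).1.ne'), ← Complex.ofReal_log (h k).1.le, (h k).2,
      ← Finset.mul_sum, mul_comm]
    push_cast
    rfl
  rw [Finset.prod_congr rfl fun k _ => h1 k, ← Complex.exp_sum, Finset.sum_comm]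
  congr 1
  refine Finset.sum_congr rfl fun l _ => ?_
  rw [Finset.sum_mul]
  refine Finset.sum_congr rfl fun k _ => ?_
  push_cast
  ring

/-- The coordinates of the real linear form `x ↦ Re (∑ α_i x_i)`. The frequency of the character
`ψ_a` in real coordinates is its value at `a`, multiplied by `[F_v : ℝ]`. -/
noncomputable def frequency : (Fin n → 𝕜) →ₗ[ℝ] (Fin N → ℝ) :=
  LinearMap.pi fun j => ∑ i, RCLike.reLm ∘ₗ
    LinearMap.mulRight ℝ (e (Pi.single j 1) i) ∘ₗ (LinearMap.proj i : (Fin n → 𝕜) →ₗ[ℝ] 𝕜)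

theorem sum_frequency_mul (α : Fin n → 𝕜) (y : Fin N → ℝ) :
    ∑ j, frequency e α j * y j = RCLike.re (∑ i, α i * e y i) := by
  have h1 (i : Fin n) : e y i = ∑ j, (y j : 𝕜) * e (Pi.single j 1) i := by
    conv_lhs => rw [pi_eq_sum_univ' y]
    simp [map_sum, RCLike.real_smul_eq_coe_mul]
  simp only [h1, frequency, LinearMap.pi_apply, LinearMap.sum_apply, LinearMap.comp_apply,
    LinearMap.mulRight_apply, LinearMap.proj_apply, RCLike.reLm_coe, Finset.sum_mul,
    Finset.mul_sum, map_sum]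
  rw [Finset.sum_comm]
  refine Finset.sum_congr rfl fun i _ => Finset.sum_congr rfl fun j _ => ?_
  rw [mul_left_comm, RCLike.re_ofReal_mul, mul_comm]

theorem exists_norm_le_mul_norm_frequency :
    ∃ K, 0 ≤ K ∧ ∀ α : Fin n → 𝕜, ‖α‖ ≤ K * ‖frequency e α‖ := by
  have hker : LinearMap.ker (frequency e) = ⊥ := by
    refine LinearMap.ker_eq_bot'.2 fun α hα => ?_
    have h := sum_frequency_mul e α (e.symm fun i => star (α i))
    rw [hα, e.apply_symm_apply] at h
    have h2 (i : Fin n) : RCLike.re (α i * star (α i)) = ‖α i‖ ^ 2 := by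
      rw [RCLike.star_def, RCLike.mul_conj, ← RCLike.ofReal_pow, RCLike.ofReal_re]
    simp only [Pi.zero_apply, zero_mul, Finset.sum_const_zero, map_sum, h2] at h
    funext i
    have h3 := (Finset.sum_eq_zero_iff_of_nonneg fun i _ => sq_nonneg ‖α i‖).1 h.symm i
      (Finset.mem_univ i)
    simpa using h3
  obtain ⟨K, -, hK⟩ := (frequency e).exists_antilipschitzWith hker
  refine ⟨K, K.2, fun α => ?_⟩
  simpa using hK.le_mul_dist α 0

theorem psi_realCoord
    (htr : ∀ x, (InfinitePlace.Completion.extensionEmbedding v x).re = RCLike.re (φ x))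
    (a : Fin n → v.Completion) (y : Fin N → ℝ) :
    ArchimedeanPlace.psi v a (realCoord φ e y)
      = character ((v.mult : ℝ) • frequency e fun i => φ (a i)) y := by
  have h : ArchimedeanPlace.traceReal v (∑ i, a i * realCoord φ e y i)
      = ∑ i, ((v.mult : ℝ) • frequency e fun i => φ (a i)) i * y i := by
    rw [ArchimedeanPlace.traceReal, htr, map_sum]
    simp only [map_mul, realCoord, RingEquiv.apply_symm_apply, Pi.smul_apply, smul_eq_mul,
      mul_assoc, ← Finset.mul_sum]
    rw [sum_frequency_mul]
  rw [ArchimedeanPlace.psi, character, h]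

include hφ

theorem sum_norm_sq_cons_realCoord (y : Fin N → ℝ) :
    ∑ i, ‖(Fin.cons 1 (realCoord φ e y) : Fin (n + 1) → v.Completion) i‖ ^ 2
      = ∑ i, ‖chart e y i‖ ^ 2 :=
  Finset.sum_congr rfl fun i _ => by rw [← hφ, apply_cons_realCoord]

theorem norm_aeval_cons_realCoord (y : Fin N → ℝ) (g : MvPolynomial (Fin (n + 1)) F) :
    ‖aeval (Fin.cons 1 (realCoord φ e y) : Fin (n + 1) → v.Completion) g‖
      = ‖eval (chart e y)
          (MvPolynomial.map ((φ : v.Completion →+* 𝕜).comp (algebraMap F v.Completion)) g)‖ := by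
  rw [← hφ, aeval_def, eval_map]
  congr 1
  have h := hom_eval₂ g (algebraMap F v.Completion) (φ : v.Completion →+* 𝕜)
    (Fin.cons 1 (realCoord φ e y) : Fin (n + 1) → v.Completion)
  refine h.trans ?_
  congr 1
  funext i
  exact apply_cons_realCoord φ e y i

/-- In real coordinates the logarithms of the norms of the canonical sections are linear
combinations of logarithms of tame polynomials. -/
theorem exists_log_sectionNorm_eq (B : BlowupCentres F n r) :
    ∃ (P : Fin (r + 1) → MvPolynomial (Fin N) ℝ) (M : Fin (r + 1) → Fin (r + 1) → ℝ),
      (∀ l, Tame (P l)) ∧ (∀ y, 1 ≤ eval y (P 0)) ∧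
      (∃ c, 0 < c ∧ ∀ y : Fin N → ℝ, c * (1 + ‖y‖) ≤ eval y (P 0)) ∧
      ∀ y k, 0 < B.sectionNorm v (Fin.cons 1 (realCoord φ e y)) k ∧
        Real.log (B.sectionNorm v (Fin.cons 1 (realCoord φ e y)) k)
          = ∑ l, M k l * Real.log (eval y (P l)) := by
  set f : F →+* 𝕜 := (φ : v.Completion →+* 𝕜).comp (algebraMap F v.Completion) with hf
  obtain ⟨Q, hQ, hQe⟩ := exists_tame_sum_norm_sq_chart e
  have hP (k : Fin r) := exists_tame_sum_norm_sq_div e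
    (fun j => MvPolynomial.map f (B.gen k j)) (B.deg k)
    (fun j => (B.gen_homogeneous k j).map f) (by
      have h := Ideal.mem_map_of_mem (MvPolynomial.map f) (B.X_zero_mem_ideal k)
      rwa [Ideal.map_span, map_X, ← Set.range_comp] at h)
  choose P D hPt hPe using hP
  have hcn (k : Fin r) (y : Fin N → ℝ) : B.centreNorm v k (Fin.cons 1 (realCoord φ e y))
      = Real.sqrt (eval y (P k) / eval y Q ^ D k) := by
    rw [BlowupCentres.centreNorm, hQe, ← hPe, sum_norm_sq_cons_realCoord φ hφ]
    simp only [norm_aeval_cons_realCoord φ hφ]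
    rfl
  have hcpos (k : Fin r) (y : Fin N → ℝ) :
      0 < B.centreNorm v k (Fin.cons 1 (realCoord φ e y)) := by
    rw [hcn]
    exact Real.sqrt_pos.2 (div_pos ((hPt k).pos y) (pow_pos (hQ.pos y) _))
  have hclog (k : Fin r) (y : Fin N → ℝ) :
      Real.log (B.centreNorm v k (Fin.cons 1 (realCoord φ e y)))
        = -(D k : ℝ) / 2 * Real.log (eval y Q) + 1 / 2 * Real.log (eval y (P k)) := by
    rw [hcn, Real.log_sqrt (div_pos ((hPt k).pos y) (pow_pos (hQ.pos y) _)).le,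
      Real.log_div ((hPt k).pos y).ne' (pow_pos (hQ.pos y) _).ne', Real.log_pow]
    ring
  have hh (y : Fin N → ℝ) : BlowupCentres.hyperplaneNorm v (Fin.cons 1 (realCoord φ e y))
      = (Real.sqrt (eval y Q))⁻¹ := by
    rw [BlowupCentres.hyperplaneNorm, sum_norm_sq_cons_realCoord φ hφ, hQe, Fin.cons_zero,
      norm_one, one_div]
  refine ⟨Fin.cons Q P,
    Fin.cons (Fin.cons (-1 / 2 + ∑ k, (D k : ℝ) / 2) fun _ => -1 / 2)
      fun k => Fin.cons (-(D k : ℝ) / 2) (Pi.single k (1 / 2)), ?_, ?_, ?_, fun y k => ?_⟩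
  · exact Fin.cases hQ hPt
  · intro y
    rw [Fin.cons_zero, hQe]
    exact one_le_sum_norm_sq_chart e y
  · obtain ⟨c, hc, h⟩ := exists_le_sum_norm_sq_chart e
    refine ⟨c, hc, fun y => ?_⟩
    rw [Fin.cons_zero, hQe]
    refine le_trans ?_ (h y)
    refine mul_le_mul_of_nonneg_left ?_ hc.le
    nlinarith [norm_nonneg y]
  · refine Fin.cases ?_ (fun k => ?_) k
    · simp only [BlowupCentres.sectionNorm, Fin.cons_zero, Fin.sum_univ_succ, Fin.cons_succ]
      have h1 : 0 < BlowupCentres.hyperplaneNorm v (Fin.cons 1 (realCoord φ e y)) := by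
        rw [hh]
        exact inv_pos.2 (Real.sqrt_pos.2 (hQ.pos y))
      have h2 : 0 < ∏ k, B.centreNorm v k (Fin.cons 1 (realCoord φ e y)) :=
        Finset.prod_pos fun k _ => hcpos k y
      refine ⟨div_pos h1 h2, ?_⟩
      rw [Real.log_div h1.ne' h2.ne', Real.log_prod fun k _ => (hcpos k y).ne', hh, Real.log_inv,
        Real.log_sqrt (hQ.pos y).le]
      simp only [hclog, Finset.sum_add_distrib, ← Finset.sum_mul, ← Finset.mul_sum, neg_div,
        Finset.sum_neg_distrib]
      ring
    · simp only [BlowupCentres.sectionNorm, Fin.cons_succ, Fin.sum_univ_succ, Fin.cons_zero]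
      refine ⟨hcpos k y, ?_⟩
      rw [hclog, Finset.sum_eq_single k (fun i _ hi => by simp [hi]) (by simp), Pi.single_eq_same]

theorem exists_haarPi_eq_smul_map [MeasurableSpace 𝕜] [BorelSpace 𝕜] (ν : Measure 𝕜)
    [ν.IsAddHaarMeasure] (hν : ArchimedeanPlace.haar v = ν.map φ.symm) :
    ∃ C : ℝ≥0∞, C ≠ 0 ∧ C ≠ ∞ ∧ MeasurableEmbedding (realCoord φ e) ∧
      ArchimedeanPlace.haarPi v n = C • (volume : Measure (Fin N → ℝ)).map (realCoord φ e) := by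
  have hiso : Isometry φ.symm :=
    AddMonoidHomClass.isometry_of_norm φ.symm fun x => by rw [← hφ, φ.apply_symm_apply]
  let m : 𝕜 ≃ᵐ v.Completion :=
    (IsometryEquiv.mk φ.symm.toEquiv hiso).toHomeomorph.toMeasurableEquiv
  let T : (Fin n → 𝕜) ≃ᵐ (Fin n → v.Completion) := MeasurableEquiv.piCongrRight fun _ => m
  have hT : realCoord φ e = T ∘ e := rfl
  have he : Measurable e := e.continuous.measurable
  have : SigmaFinite (ν.map φ.symm) := m.sigmaFinite_map
  have : ((volume : Measure (Fin N → ℝ)).map e).IsAddHaarMeasure := e.isAddHaarMeasure_map _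
  have h := Measure.isAddLeftInvariant_eq_smul (Measure.pi fun _ : Fin n => ν)
    ((volume : Measure (Fin N → ℝ)).map e)
  have hpos := Measure.addHaarScalarFactor_pos_of_isAddHaarMeasure
    (Measure.pi fun _ : Fin n => ν) ((volume : Measure (Fin N → ℝ)).map e)
  set C := Measure.addHaarScalarFactor (Measure.pi fun _ : Fin n => ν)
    ((volume : Measure (Fin N → ℝ)).map e)
  refine ⟨C, ENNReal.coe_ne_zero.2 hpos.ne', ENNReal.coe_ne_top, ?_, ?_⟩
  · rw [hT]
    exact T.measurableEmbedding.comp e.toHomeomorph.measurableEmbedding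
  · have hpi : (Measure.pi fun _ : Fin n => ν).map T = Measure.pi fun _ : Fin n => ν.map φ.symm :=
      Measure.pi_map_pi (f := fun _ => (φ.symm : 𝕜 → v.Completion)) fun _ =>
        m.measurable.aemeasurable
    rw [ArchimedeanPlace.haarPi, hν, ← hpi, h, Measure.map_smul, hT,
      Measure.map_map T.measurable he]
    rfl

/-- The bound for the local Fourier transform, for an identification of `F_v` with `ℝ` or `ℂ`. -/
theorem exists_norm_localFourier_le [MeasurableSpace 𝕜] [BorelSpace 𝕜] (ν : Measure 𝕜)
    [ν.IsAddHaarMeasure] (hν : ArchimedeanPlace.haar v = ν.map φ.symm)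
    (htr : ∀ x, (InfinitePlace.Completion.extensionEmbedding v x).re = RCLike.re (φ x))
    (B : BlowupCentres F n r) (K : Set (Fin (r + 1) → ℝ)) (hK : IsCompact K)
    (hint : ∀ σ ∈ K, Integrable (fun x => (B.localHeight v (fun k => (σ k : ℂ)) x)⁻¹)
      (ArchimedeanPlace.haarPi v n)) (d : ℕ) :
    ∃ c : ℝ, ∀ (a : Fin n → v.Completion) (s : Fin (r + 1) → ℂ),
      (fun k => (s k).re) ∈ K →
        ‖B.localFourier v s a‖ ≤ c * ((1 + ‖fun k => (s k).im‖) / (1 + ‖a‖)) ^ d := by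
  let e : (Fin (Module.finrank ℝ (Fin n → 𝕜)) → ℝ) ≃L[ℝ] (Fin n → 𝕜) :=
    ContinuousLinearEquiv.ofFinrankEq (by simp)
  obtain ⟨C, hC0, hC, hemb, hvol⟩ := exists_haarPi_eq_smul_map φ hφ e ν hν
  obtain ⟨P, M, hP, hQ1, hQ, hlog⟩ := exists_log_sectionNorm_eq φ hφ e B
  -- the exponents of the polynomials as functions of the parameters
  set lam : (Fin (r + 1) → ℂ) → Fin (r + 1) → ℂ :=
    fun s l => ∑ k, ((v.mult * M k l : ℝ) : ℂ) * s k with hlam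
  set lamR : (Fin (r + 1) → ℝ) → Fin (r + 1) → ℝ :=
    fun σ l => ∑ k, (v.mult * M k l) * σ k with hlamR
  have hre (s : Fin (r + 1) → ℂ) : (fun l => (lam s l).re) = lamR fun k => (s k).re := by
    funext l
    simp only [hlam, hlamR, Complex.re_sum, Complex.re_ofReal_mul]
  have hH (s : Fin (r + 1) → ℂ) (y) :
      (B.localHeight v s (realCoord φ e y))⁻¹ = cpowProd P (lam s) y :=
    localHeight_inv_eq_cpowProd (hlog y) s
  have hint' : ∀ τ ∈ lamR '' K, Integrable fun y => Real.exp (logProd P τ y) := by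
    rintro _ ⟨σ, hσ, rfl⟩
    have h1 := hint σ hσ
    rw [hvol, integrable_smul_measure hC0 hC, hemb.integrable_map_iff] at h1
    refine h1.norm.congr (ae_of_all _ fun y => ?_)
    simp only [Function.comp_apply, hH, norm_cpowProd, hre, Complex.ofReal_re]
  obtain ⟨m, hm⟩ := exists_integral_exp_logProd_le hP
    (hK.image (by fun_prop : Continuous lamR)) hint' (P 0) hQ1 hQ
  obtain ⟨A, hA, hdec⟩ := exists_pow_mul_norm_fourier_le hP d
  obtain ⟨k₁, hk₁, hfreq⟩ := exists_norm_le_mul_norm_frequency e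
  obtain ⟨ρ, hρ0, hρ⟩ := hK.isBounded.exists_pos_norm_le
  -- `lam` is Lipschitz, so that `1 + ‖lam s‖` is bounded in terms of the imaginary part of `s`
  set S := ∑ k, ∑ l, |v.mult * M k l| with hS
  have hS0 : 0 ≤ S := by positivity
  have hlamle (s : Fin (r + 1) → ℂ) : ‖lam s‖ ≤ S * ‖s‖ := by
    refine (pi_norm_le_iff_of_nonneg (by positivity)).2 fun l => ?_
    refine (norm_sum_le _ _).trans ?_
    rw [hS, Finset.sum_mul]
    refine Finset.sum_le_sum fun k _ => ?_
    rw [norm_mul, Complex.norm_real, Real.norm_eq_abs]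
    refine mul_le_mul ?_ (norm_le_pi_norm s k) (norm_nonneg _) (by positivity)
    exact Finset.single_le_sum (f := fun l => |v.mult * M k l|) (fun _ _ => abs_nonneg _)
      (Finset.mem_univ l)
  have hsle (s : Fin (r + 1) → ℂ) : ‖s‖ ≤ ‖fun k => (s k).re‖ + ‖fun k => (s k).im‖ := by
    refine (pi_norm_le_iff_of_nonneg (by positivity)).2 fun k => ?_
    refine (Complex.norm_le_abs_re_add_abs_im _).trans (add_le_add ?_ ?_)
    · exact norm_le_pi_norm (fun k => (s k).re) k
    · exact norm_le_pi_norm (fun k => (s k).im) k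
  refine ⟨C.toReal * (A * (1 + S * (ρ + 1)) ^ d * m * (1 + k₁) ^ d), fun a s hs => ?_⟩
  set b := (v.mult : ℝ) • frequency e fun i => φ (a i) with hb
  have hF : B.localFourier v s a
      = C.toReal • ∫ y, cpowProd P (lam s) y * character b y := by
    rw [BlowupCentres.localFourier, hvol, integral_smul_measure, hemb.integral_map]
    simp only [hH, psi_realCoord φ e htr]
    rfl
  have hmem : (fun l => (lam s l).re) ∈ lamR '' K := ⟨_, hs, (hre s).symm⟩
  have h1 := hdec (lam s) b (hint' _ hmem)
  have h2 := hm _ hmem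
  have hm0 : 0 ≤ m := le_trans (integral_nonneg fun y => (Real.exp_pos _).le) h2
  have h3 : 1 + ‖lam s‖ ≤ (1 + S * (ρ + 1)) * (1 + ‖fun k => (s k).im‖) := by
    have h4 := hlamle s
    have h5 := hsle s
    have h6 := hρ _ hs
    have h7 := norm_nonneg fun k => (s k).im
    nlinarith [mul_nonneg hS0 h7, mul_nonneg (mul_nonneg hS0 hρ0.le) h7,
      mul_le_mul_of_nonneg_left h5 hS0, mul_le_mul_of_nonneg_left h6 hS0]
  have h4 : 1 + ‖a‖ ≤ (1 + k₁) * (1 + ‖b‖) := by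
    have h5 : ‖a‖ = ‖fun i => φ (a i)‖ := by simp only [Pi.norm_def, nnnorm, hφ]
    have h6 := hfreq fun i => φ (a i)
    have h7 : ‖frequency e fun i => φ (a i)‖ ≤ ‖b‖ := by
      rw [hb, norm_smul, Real.norm_natCast]
      refine le_mul_of_one_le_left (norm_nonneg _) ?_
      exact_mod_cast v.mult_pos
    rw [h5]
    nlinarith [norm_nonneg b, mul_le_mul_of_nonneg_left h7 hk₁]
  rw [hF, norm_smul, Real.norm_of_nonneg ENNReal.toReal_nonneg, mul_assoc]
  refine mul_le_mul_of_nonneg_left ?_ ENNReal.toReal_nonneg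
  rw [div_pow, mul_div_assoc', le_div_iff₀ (by positivity)]
  set I := ‖∫ y, cpowProd P (lam s) y * character b y‖
  calc I * (1 + ‖a‖) ^ d ≤ I * ((1 + k₁) * (1 + ‖b‖)) ^ d := by gcongr
    _ = (1 + k₁) ^ d * ((1 + ‖b‖) ^ d * I) := by rw [mul_pow]; ring
    _ ≤ (1 + k₁) ^ d * (A * (1 + ‖lam s‖) ^ d * m) := by
        refine mul_le_mul_of_nonneg_left (h1.trans ?_) (by positivity)
        gcongr
    _ ≤ (1 + k₁) ^ d *
          (A * ((1 + S * (ρ + 1)) * (1 + ‖fun k => (s k).im‖)) ^ d * m) := by gcongr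
    _ = _ := by rw [mul_pow]; ring

end ArchimedeanPlace

theorem mainTheorem8 {F : Type*} [Field F] [NumberField F] {n r : ℕ}
    (B : BlowupCentres F n r) (v : InfinitePlace F)
    (K : Set (Fin (r + 1) → ℝ)) (hK : IsCompact K)
    (hint : ∀ σ ∈ K, Integrable (fun x => (B.localHeight v (fun k => (σ k : ℂ)) x)⁻¹)
      (ArchimedeanPlace.haarPi v n))
    (d : ℕ) (hd : 1 ≤ d) :
    ∃ c : ℝ, ∀ (a : Fin n → v.Completion) (s : Fin (r + 1) → ℂ),
      (fun k => (s k).re) ∈ K →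
        ‖B.localFourier v s a‖ ≤ c * ((1 + ‖fun k => (s k).im‖) / (1 + ‖a‖)) ^ d := by
  by_cases hv : v.IsReal
  · refine ArchimedeanPlace.exists_norm_localFourier_le
      (InfinitePlace.Completion.ringEquivRealOfIsReal hv)
      (fun x => ?_) volume ?_ (fun x => ?_) B K hK hint d
    · exact (InfinitePlace.Completion.isometryEquivRealOfIsReal hv).isometry.norm_map_of_map_zero
        (map_zero (InfinitePlace.Completion.ringEquivRealOfIsReal hv)) x
    · rw [ArchimedeanPlace.haar, dif_pos hv]
      rfl
    · rw [← InfinitePlace.Completion.extensionEmbeddingOfIsReal_apply hv]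
      rfl
  · have hc := InfinitePlace.not_isReal_iff_isComplex.mp hv
    have h2 : ((2 : ℝ≥0∞) • (volume : Measure ℂ)).IsAddHaarMeasure :=
      Measure.IsAddHaarMeasure.smul _ two_ne_zero ENNReal.ofNat_ne_top
    refine ArchimedeanPlace.exists_norm_localFourier_le
      (InfinitePlace.Completion.ringEquivComplexOfIsComplex hc)
      (fun x => ?_) ((2 : ℝ≥0∞) • volume) ?_ (fun x => rfl) B K hK hint d
    · exact (InfinitePlace.Completion.isometryEquivComplexOfIsComplex
        hc).isometry.norm_map_of_map_zero
          (map_zero (InfinitePlace.Completion.ringEquivComplexOfIsComplex hc)) x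
    · rw [ArchimedeanPlace.haar, dif_neg hv, Measure.map_smul]
      rfl
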